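/- Let $\Omega^+=\{1,\dots,k\}^{\mathbb N}$ (with $\mathbb N=\{0,1,2,\dots\}$), with its product $\sigma$-algebra and shift $(\sigma\omega)_i=\omega_{i+1}$, and let $\mathbb P$ be a $\sigma$-invariant probability measure on $\Omega^+$ that is Markovian (the coordinates form a Markov chain) and full (every non-empty cylinder set has positive probability). Write $\mathbb P$ also for its two-sided stationary extension, that is, the $\sigma$-invariant probability measure on $\Omega=\{1,\dots,k\}^{\mathbb Z}$ whose image under $r^+(\omega)=(\omega_0,\omega_1,\dots)$ is the given measure on $\Omega^+$. Let $\varphi$ be a linear random dynamical system on $\mathbb R^d$ over $\Omega^+$: a measurable family of linear maps $\varphi(n,\omega)$ ($n\in\mathbb N$, $\omega\in\Omega^+$) with $\varphi(0,\omega)=\mathrm{Id}$ and $\varphi(m+n,\omega)=\varphi(n,\sigma^m\omega)\,\varphi(m,\omega)$. Suppose that $M(\omega)=\varphi(1,\omega)$ is invertible for every $\omega$ and depends only on $\omega_0$. For $\omega\in\Omega$ write $\varphi(n,\sigma^{-n}\omega)$ for $\varphi(n,r^+(\sigma^{-n}\omega))$. Let $\mathcal S_\varphi=\{\varphi(n,\omega):n\ge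 0,\ \omega\in\Omega^+\}$, and suppose that - $\varphi$ is strongly irreducible: there is no finite non-empty family $V_1,\dots,V_m$ of linear subspaces of $\mathbb R^d$, each different from $\{0\}$ and from $\mathbb R^d$, with $A(V_1\cup\dots\cup V_m)=V_1\cup\dots\cup V_m$ for every $A\in\mathcal S_\varphi$; - $\varphi$ has index $r$: $r$ is the least integer for which there is a sequence $(M_i)$ in $\mathcal S_\varphi$ such that $M_i/\|M_i\|$ converges to a matrix of rank $r$. Then for $\mathbb P$-almost every $\omega\in\Omega$ there is an $r$-dimensional subspace $V(\omega)$ of $\mathbb R^d$ that is the range of every limit point, as $n\to\infty$, of the sequence $\varphi(n,\sigma^{-n}\omega)/\|\varphi(n,\sigma^{-n}\omega)\|$. Moreover, for every non-zero $x\in\mathbb R^d$, $\mathbb P\{\omega: x\perp V(\omega)\}=0$. -/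

import Mathlib

open MeasureTheory Filter Topology

noncomputable section

/-- Euclidean space `ℝ^d`. -/
abbrev Eucl (d : ℕ) : Type := EuclideanSpace ℝ (Fin d)

/-- The one-sided shift `(σ ω)_i = ω_{i+1}` on sequences indexed by `ℕ`. -/
def oneSidedShift {E : Type*} (ω : ℕ → E) : ℕ → E := fun i => ω (i + 1)

/-- The two-sided shift `(σ ω)_i = ω_{i+1}` on sequences indexed by `ℤ`, as a bijection. -/
def twoSidedShift {E : Type*} : (ℤ → E) ≃ (ℤ → E) where
  toFun ω := fun i => ω (i + 1)
  invFun ω := fun i => ω (i - 1)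
  left_inv ω := by funext i; simp
  right_inv ω := by funext i; simp

/-- The restriction `r⁺(ω) = (ω_0, ω_1, …)` from two-sided to one-sided sequences. -/
def restrictPlus {E : Type*} (ω : ℤ → E) : ℕ → E := fun i => ω (i : ℤ)

/-- The coordinate process is a Markov chain under `P`: given any initial word of positive
probability, the conditional law of the next symbol depends on the last symbol only. -/
def IsMarkovian {E : Type*} [MeasurableSpace E] (P : Measure (ℕ → E)) : Prop :=
  ∀ (n : ℕ) (w : ℕ → E) (j : E), P {ω | ∀ i ≤ n, ω i = w i} ≠ 0 →
    ProbabilityTheory.cond P {ω | ∀ i ≤ n, ω i = w i} {ω | ω (n + 1) = j} =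
      ProbabilityTheory.cond P {ω | ω n = w n} {ω | ω (n + 1) = j}

/-- Every non-empty cylinder set has positive probability. -/
def IsFull {E : Type*} [MeasurableSpace E] (P : Measure (ℕ → E)) : Prop :=
  ∀ (s : Finset ℕ) (w : ℕ → E), 0 < P {ω | ∀ i ∈ s, ω i = w i}

/-- `P` makes the sequence space over `{1, …, k}` a one-sided Markovian full shift. -/
structure IsMarkovianFullShift {k : ℕ} (P : Measure (ℕ → Fin k)) : Prop where
  prob : IsProbabilityMeasure P
  invariant : MeasurePreserving oneSidedShift P P
  markovian : IsMarkovian P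
  full : IsFull P

/-- `P₂` is the two-sided stationary extension of the one-sided stationary measure `P`: it is
invariant under the two-sided shift, and forgetting the past turns it into `P`. -/
structure IsTwoSidedExtension {k : ℕ} (P : Measure (ℕ → Fin k)) (P₂ : Measure (ℤ → Fin k)) :
    Prop where
  invariant : MeasurePreserving twoSidedShift P₂ P₂
  map_restrict : P₂.map restrictPlus = P

/-- A linear random dynamical system on `ℝ^d` (in one-sided time) over the one-sided shift on `k`
symbols. -/
structure LRDS (k d : ℕ) where
  φ : ℕ → (ℕ → Fin k) → (Eucl d →L[ℝ] Eucl d)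
  measurable : Measurable fun p : ℕ × (ℕ → Fin k) × Eucl d => φ p.1 p.2.1 p.2.2
  zero : ∀ ω, φ 0 ω = ContinuousLinearMap.id ℝ (Eucl d)
  cocycle : ∀ m n ω, φ (m + n) ω = (φ n (oneSidedShift^[m] ω)).comp (φ m ω)

namespace LRDS

variable {k d : ℕ}

/-- `φ(1, ω)` is an automorphism of `ℝ^d` for every `ω`. -/
def SpatiallyInvertible (Φ : LRDS k d) : Prop := ∀ ω, IsUnit (Φ.φ 1 ω)

/-- `φ(1, ω)` depends only on the first coordinate `ω_0`. -/
def DependsOnFirst (Φ : LRDS k d) : Prop := ∀ ω ω', ω 0 = ω' 0 → Φ.φ 1 ω = Φ.φ 1 ω'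

/-- The semigroup `{φ(n, ω) : n ≥ 0, ω ∈ Ω⁺}`. -/
def semigroup (Φ : LRDS k d) : Set (Eucl d →L[ℝ] Eucl d) := {A | ∃ n ω, A = Φ.φ n ω}

/-- No finite non-empty family of proper non-zero linear subspaces has a union that is mapped onto
itself by every element of the semigroup. -/
def StronglyIrreducible (Φ : LRDS k d) : Prop :=
  ¬ ∃ (m : ℕ) (W : Fin m → Submodule ℝ (Eucl d)), 0 < m ∧ (∀ i, W i ≠ ⊥ ∧ W i ≠ ⊤) ∧
    ∀ A ∈ Φ.semigroup, A '' (⋃ i, (W i : Set (Eucl d))) = ⋃ i, (W i : Set (Eucl d))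

/-- The ranks of the limits of convergent sequences `M_i / ‖M_i‖` with `M_i` in the semigroup. -/
def limitRanks (Φ : LRDS k d) : Set ℕ :=
  {ρ | ∃ (M : ℕ → (Eucl d →L[ℝ] Eucl d)) (L : Eucl d →L[ℝ] Eucl d), (∀ i, M i ∈ Φ.semigroup) ∧
    Tendsto (fun i => ‖M i‖⁻¹ • M i) atTop (𝓝 L) ∧
    Module.finrank ℝ (LinearMap.range (L : Eucl d →ₗ[ℝ] Eucl d)) = ρ}

/-- `r` is the least rank of a limit of normalised elements of the semigroup. -/
def HasIndex (Φ : LRDS k d) (r : ℕ) : Prop := IsLeast Φ.limitRanks r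

/-- The product `φ(n, σ^{-n} ω)` for a two-sided sequence `ω`; the one-sided system acts on
two-sided sequences through `r⁺`. -/
def pullback (Φ : LRDS k d) (n : ℕ) (ω : ℤ → Fin k) : Eucl d →L[ℝ] Eucl d :=
  Φ.φ n (restrictPlus (twoSidedShift.symm^[n] ω))

end LRDS

end

/-! Read backwards from time -1, the letters of a two-sided sequence form the time-reversed Markov
chain, whose transition weights `reversed P` are all positive because `P` is full. The pullback
product is M(ω_{-1}) M(ω_{-2}) ⋯ M(ω_{-n}), so each new letter multiplies on the right. This is the
setting of Furstenberg's martingale argument.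

Choose probability measures ν_o on the unit sphere, one for each state o of the reversed chain
(`none` is the state before any letter), with ν_o = ∑_j q(o,j) (A_j)_* ν_j (`exists_stationary`).
Strong irreducibility prevents them from charging a proper subspace: among charged subspaces of
least dimension, those of greatest mass would form a finite family permuted by the maps
(`exists_finite_invariant_family`). By stationarity, the integral of a continuous f against the
image of ν_o under the product is a harmonic function of the past word (`step_average`), hence a
bounded martingale. It converges almost surely. Since its increments are summable in mean square and
the weights are bounded below, its limit is unchanged when the word is extended by any fixed word
(`ae_tendsto_past_append`).

If R is a limit point of the normalised products, the limit for quadratic f is a second moment of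
the image of ν_o under R. As ν_o is proper, the second moments determine the range of R, so all
limit points have the same range. Extending by words whose normalised products tend to a limit L of
rank r shows that R and some nonzero R g L A_j have equal range, so R has rank at most r; minimality
of r gives equality. Finally, if x is orthogonal to the range, the martingale of a tent function
around the hyperplane orthogonal to x tends to 1. Its mean is its value at the empty word, which is
arbitrarily small for narrow tents because ν_none is proper. -/

noncomputable section

namespace RandomProduct

/-! ### Stationary families of measures -/

section Stationary

variable {J X : Type*} [Fintype J] [MeasurableSpace X]

/-- The averaged push-forward of a family of measures indexed by the states `Option J`: in state
`o` the letter `j` is chosen with weight `q o j` and the map `g j` is applied. -/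
def transfer (q : Option J → J → ℝ) (g : J → X → X) (ν : Option J → Measure X) (o : Option J) :
    Measure X :=
  ∑ j, ENNReal.ofReal (q o j) • (ν (some j)).map (g j)

variable {q : Option J → J → ℝ} {g : J → X → X}

lemma isProbabilityMeasure_transfer (hq0 : ∀ o j, 0 ≤ q o j) (hq1 : ∀ o, ∑ j, q o j = 1)
    (hg : ∀ j, Measurable (g j)) {ν : Option J → Measure X} (hν : ∀ o, IsProbabilityMeasure (ν o))
    (o : Option J) : IsProbabilityMeasure (transfer q g ν o) := by
  constructor
  simp only [transfer, Measure.coe_finsetSum, Finset.sum_apply, Measure.smul_apply, smul_eq_mul]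
  have : ∀ j, (ν (some j)).map (g j) Set.univ = 1 := fun j => by
    rw [Measure.map_apply (hg j) MeasurableSet.univ]; simp
  simp only [this, mul_one]
  rw [← ENNReal.ofReal_sum_of_nonneg (fun j _ => hq0 o j), hq1, ENNReal.ofReal_one]

lemma integral_transfer (hq0 : ∀ o j, 0 ≤ q o j)
    (hg : ∀ j, Measurable (g j)) {ν : Option J → Measure X} (hν : ∀ o, IsProbabilityMeasure (ν o))
    {f : X → ℝ} (hf : Measurable f) {C : ℝ} (hC : ∀ j x, |f (g j x)| ≤ C) (o : Option J) :
    ∫ x, f x ∂(transfer q g ν o) = ∑ j, q o j * ∫ x, f (g j x) ∂(ν (some j)) := by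
  have hi : ∀ j, Integrable f ((ν (some j)).map (g j)) := fun j => by
    rw [integrable_map_measure hf.aestronglyMeasurable (hg j).aemeasurable]
    exact Integrable.of_bound (hf.comp (hg j)).aestronglyMeasurable C
      (ae_of_all _ fun x => hC j x)
  rw [transfer, integral_finsetSum_measure]
  · refine Finset.sum_congr rfl fun j _ => ?_
    rw [integral_smul_measure, integral_map (hg j).aemeasurable hf.aestronglyMeasurable,
      ENNReal.toReal_ofReal (hq0 o j), smul_eq_mul]
  · exact fun j _ => (hi j).smul_measure ENNReal.ofReal_ne_top

end Stationary

/-- Existence of a stationary family of probability measures on a compact metric space. -/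
lemma exists_stationary_of_compact {J X : Type*} [Fintype J] [MetricSpace X] [CompactSpace X]
    [MeasurableSpace X] [BorelSpace X] [Nonempty X] {q : Option J → J → ℝ} {g : J → X → X}
    (hq0 : ∀ o j, 0 ≤ q o j) (hq1 : ∀ o, ∑ j, q o j = 1) (hg : ∀ j, Continuous (g j)) :
    ∃ ν : Option J → Measure X, (∀ o, IsProbabilityMeasure (ν o)) ∧
      ∀ o, ν o = transfer q g ν o := by
  classical
  have hgm : ∀ j, Measurable (g j) := fun j => (hg j).measurable
  let x₀ : X := Classical.arbitrary X
  let τ : ℕ → Option J → Measure X := fun n => (transfer q g)^[n] fun _ => Measure.dirac x₀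
  have τ_succ : ∀ n, τ (n + 1) = transfer q g (τ n) := fun n =>
    Function.iterate_succ_apply' _ _ _
  have τ_prob : ∀ n o, IsProbabilityMeasure (τ n o) := by
    intro n
    induction n with
    | zero => intro o; exact Measure.dirac.isProbabilityMeasure
    | succ n ih => intro o; rw [τ_succ]; exact isProbabilityMeasure_transfer hq0 hq1 hgm ih o
  -- Krylov–Bogoliubov: average the iterates of `transfer` started at a Dirac mass.
  let c : ℕ → Option J → Measure X := fun N o =>
    ((N : ENNReal) + 1)⁻¹ • ∑ n ∈ Finset.range (N + 1), τ n o
  have c_prob : ∀ N o, IsProbabilityMeasure (c N o) := by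
    intro N o
    constructor
    have : ∀ n, τ n o Set.univ = 1 := fun n => (τ_prob n o).measure_univ
    simp only [c, Measure.smul_apply, Measure.coe_finsetSum, Finset.sum_apply, this, smul_eq_mul,
      Finset.sum_const, Finset.card_range, nsmul_eq_mul, mul_one, Nat.cast_add, Nat.cast_one]
    exact ENNReal.inv_mul_cancel (by simp) (by finiteness)
  have c_int : ∀ N o (f : BoundedContinuousFunction X ℝ),
      ∫ x, f x ∂(c N o) = ((N : ℝ) + 1)⁻¹ * ∑ n ∈ Finset.range (N + 1), ∫ x, f x ∂(τ n o) := by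
    intro N o f
    rw [integral_smul_measure, integral_finsetSum_measure, smul_eq_mul]
    · congr 1
      rw [ENNReal.toReal_inv]
      norm_cast
    · intro n _
      have := τ_prob n o
      exact f.integrable _
  let cP : ℕ → Option J → ProbabilityMeasure X := fun N o => ⟨c N o, c_prob N o⟩
  -- Families of probability measures on a compact space form a compact space, so an ultrafilter
  -- limit exists for all states at once.
  let ν : Option J → ProbabilityMeasure X := ((Filter.hyperfilter ℕ).map cP).lim
  have hν : Tendsto cP (Filter.hyperfilter ℕ) (𝓝 ν) :=
    ((Filter.hyperfilter ℕ).map cP).le_nhds_lim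
  have h_int : ∀ o (f : BoundedContinuousFunction X ℝ),
      Tendsto (fun N => ∫ x, f x ∂(c N o)) (Filter.hyperfilter ℕ)
        (𝓝 (∫ x, f x ∂(ν o : Measure X))) := fun o =>
    ProbabilityMeasure.tendsto_iff_forall_integral_tendsto.1 (tendsto_pi_nhds.1 hν o)
  have ν_prob : ∀ o, IsProbabilityMeasure (ν o : Measure X) := fun o => inferInstance
  refine ⟨fun o => ν o, ν_prob, fun o => ?_⟩
  have := isProbabilityMeasure_transfer hq0 hq1 hgm ν_prob o
  refine ext_of_forall_integral_eq_of_IsFiniteMeasure fun f => ?_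
  have f_le : ∀ x, |f x| ≤ ‖f‖ := f.norm_coe_le_norm
  rw [integral_transfer hq0 hgm ν_prob f.continuous.measurable fun j x => f_le _]
  have h₁ : Tendsto (fun N => ∑ j, q o j * ∫ x, f (g j x) ∂(c N (some j)))
      (Filter.hyperfilter ℕ) (𝓝 (∑ j, q o j * ∫ x, f (g j x) ∂(ν (some j) : Measure X))) :=
    tendsto_finsetSum _ fun j _ =>
      (h_int (some j) (f.compContinuous ⟨g j, hg j⟩)).const_mul _
  have h₂ : ∀ N, ∑ j, q o j * ∫ x, f (g j x) ∂(c N (some j)) =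
      ((N : ℝ) + 1)⁻¹ * ∑ n ∈ Finset.range (N + 1), ∫ x, f x ∂(τ (n + 1) o) := by
    intro N
    simp_rw [τ_succ, integral_transfer hq0 hgm (τ_prob _) f.continuous.measurable
      fun j x => f_le _]
    rw [Finset.sum_comm, Finset.mul_sum]
    refine Finset.sum_congr rfl fun j _ => ?_
    rw [← Finset.mul_sum, mul_left_comm]
    congr 1
    exact c_int N (some j) (f.compContinuous ⟨g j, hg j⟩)
  have τ_le : ∀ n, |∫ x, f x ∂(τ n o)| ≤ ‖f‖ := fun n => by
    have := τ_prob n o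
    simpa using norm_integral_le_of_norm_le_const (μ := τ n o) (f := f)
      (ae_of_all _ f.norm_coe_le_norm)
  -- Averaging and transferring an average differ by a telescoping sum with two surviving terms,
  -- hence by O(1/N).
  have h₃ : Tendsto (fun N => (∫ x, f x ∂(c N o)) -
      ∑ j, q o j * ∫ x, f (g j x) ∂(c N (some j))) atTop (𝓝 0) := by
    have h₄ : Tendsto (fun N : ℕ => ((N : ℝ) + 1)⁻¹ * (2 * ‖f‖)) atTop (𝓝 0) := by
      simpa using (tendsto_inv_atTop_zero.comp
        (tendsto_atTop_add_const_right atTop (1 : ℝ) tendsto_natCast_atTop_atTop)).mul_const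
          (2 * ‖f‖)
    refine squeeze_zero_norm (fun N => ?_) h₄
    rw [h₂, c_int, ← mul_sub, ← Finset.sum_sub_distrib, Finset.sum_range_sub', norm_mul,
      Real.norm_of_nonneg (by positivity)]
    gcongr
    rw [Real.norm_eq_abs]
    refine (abs_sub _ _).trans ?_
    linarith [τ_le 0, τ_le (N + 1)]
  have h₅ := (h_int o f).sub h₁
  exact sub_eq_zero.1 (tendsto_nhds_unique h₅ (h₃.mono_left (Nat.hyperfilter_le_atTop)))

/-! ### Projective action on unit vectors -/

section Action

variable {E : Type*} [NormedAddCommGroup E] [InnerProductSpace ℝ E]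

/-- The action of a linear map on unit vectors: `u ↦ T u / ‖T u‖`. -/
def act (T : E →L[ℝ] E) (u : E) : E := ‖T u‖⁻¹ • T u

lemma norm_act_le (T : E →L[ℝ] E) (u : E) : ‖act T u‖ ≤ 1 := by
  rw [act, norm_smul, norm_inv, norm_norm]
  exact inv_mul_le_one

lemma norm_act {T : E →L[ℝ] E} {u : E} (h : T u ≠ 0) : ‖act T u‖ = 1 := by
  rw [act, norm_smul, norm_inv, norm_norm]
  exact inv_mul_cancel₀ (norm_ne_zero_iff.2 h)

/-- No nondegeneracy is needed: if `T u = 0`, both sides take the default value 0. -/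
lemma act_mul (S T : E →L[ℝ] E) (u : E) : act (S * T) u = act S (act T u) := by
  by_cases h : T u = 0
  · simp [act, h]
  · have h' : ‖T u‖ ≠ 0 := norm_ne_zero_iff.2 h
    have h₂ : (S * T) u = S (T u) := rfl
    simp only [act, h₂, map_smul, norm_smul, norm_inv, norm_norm,
      mul_inv, inv_inv, smul_smul]
    congr 1
    field_simp

lemma act_smul {c : ℝ} (hc : 0 < c) (T : E →L[ℝ] E) (u : E) : act (c • T) u = act T u := by
  simp only [act, _root_.smul_apply, norm_smul, Real.norm_of_nonneg hc.le, mul_inv,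
    smul_smul]
  congr 1
  field_simp

lemma measurable_act [MeasurableSpace E] [BorelSpace E] [SecondCountableTopology E]
    (T : E →L[ℝ] E) : Measurable (act T) := by
  unfold act
  fun_prop

/-- Existence of a stationary family of probability measures on the unit sphere. -/
lemma exists_stationary [FiniteDimensional ℝ E] [Nontrivial E] [MeasurableSpace E] [BorelSpace E]
    {J : Type*} [Fintype J] {q : Option J → J → ℝ} {A : J → E →L[ℝ] E}
    (hq0 : ∀ o j, 0 ≤ q o j) (hq1 : ∀ o, ∑ j, q o j = 1) (hA : ∀ j, IsUnit (A j)) :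
    ∃ ν : Option J → Measure E, (∀ o, IsProbabilityMeasure (ν o)) ∧
      (∀ o, ∀ᵐ u ∂(ν o), ‖u‖ = 1) ∧ ∀ o, ν o = transfer q (fun j => act (A j)) ν o := by
  have := FiniteDimensional.proper_real E
  have hA' : ∀ j (u : E), u ≠ 0 → A j u ≠ 0 := by
    intro j u hu h
    obtain ⟨B, hB⟩ := (hA j).exists_left_inv
    apply hu
    have := congrArg (fun T : E →L[ℝ] E => T u) hB
    simpa [h] using this.symm
  have hA'' : ∀ j (u : Metric.sphere (0 : E) 1), A j u ≠ 0 := fun j u =>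
    hA' j u (ne_zero_of_mem_unit_sphere u)
  let g : J → Metric.sphere (0 : E) 1 → Metric.sphere (0 : E) 1 := fun j u =>
    ⟨act (A j) u, by simpa using norm_act (hA'' j u)⟩
  have hg : ∀ j, Continuous (g j) := by
    intro j
    refine Continuous.subtype_mk ?_ _
    have : Continuous fun u : Metric.sphere (0 : E) 1 => A j u := by fun_prop
    exact (this.norm.inv₀ fun u => norm_ne_zero_iff.2 (hA'' j u)).smul this
  have : Nonempty (Metric.sphere (0 : E) 1) :=
    (NormedSpace.sphere_nonempty.2 zero_le_one).to_subtype
  obtain ⟨ν, hν, hst⟩ := exists_stationary_of_compact hq0 hq1 hg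
  refine ⟨fun o => (ν o).map (↑), fun o => ?_, fun o => ?_, fun o => ?_⟩
  · exact Measure.isProbabilityMeasure_map measurable_subtype_coe.aemeasurable
  · rw [ae_map_iff measurable_subtype_coe.aemeasurable
      (measurableSet_eq_fun measurable_norm measurable_const)]
    exact ae_of_all _ fun u => by simp
  · have h := congrArg (Measure.map ((↑) : Metric.sphere (0 : E) 1 → E)) (hst o)
    refine h.trans ?_
    simp only [transfer]
    rw [Measure.map_finset_sum measurable_subtype_coe.aemeasurable]
    refine Finset.sum_congr rfl fun j _ => ?_
    rw [Measure.map_smul, Measure.map_map measurable_subtype_coe (hg j).measurable,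
      Measure.map_map (measurable_act _) measurable_subtype_coe]
    rfl

end Action

/-! ### Stationary measures and invariant families of subspaces -/

section Proper

lemma preimage_act_submodule {E : Type*} [NormedAddCommGroup E] [InnerProductSpace ℝ E]
    (T : E →L[ℝ] E) (W : Submodule ℝ E) :
    act T ⁻¹' W = (W.comap (T : E →ₗ[ℝ] E) : Set E) := by
  ext u
  by_cases h : T u = 0
  · simp [act, h]
  · have h' : ‖T u‖⁻¹ ≠ 0 := inv_ne_zero (norm_ne_zero_iff.2 h)
    simp [act, W.smul_mem_iff h']

variable {E : Type*} [NormedAddCommGroup E] [InnerProductSpace ℝ E] [FiniteDimensional ℝ E]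
  [MeasurableSpace E] [BorelSpace E] {J : Type*} [Fintype J]

/-- A stationary family of measures charging a proper subspace produces a finite family of proper
non-zero subspaces which is permuted by the maps. -/
lemma exists_finite_invariant_family {q : Option J → J → ℝ} {A : J → E →L[ℝ] E}
    (hq0 : ∀ o j, 0 < q o j) (hq1 : ∀ o, ∑ j, q o j = 1) (hA : ∀ j, IsUnit (A j))
    {ν : Option J → Measure E} (hν : ∀ o, IsProbabilityMeasure (ν o))
    (hsph : ∀ o, ∀ᵐ u ∂(ν o), ‖u‖ = 1) (hst : ∀ o, ν o = transfer q (fun j => act (A j)) ν o)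
    (W₀ : Submodule ℝ E) (hW₀ : W₀ ≠ ⊤) (o₀ : Option J) (hpos : ν o₀ W₀ ≠ 0) :
    ∃ F : Set (Submodule ℝ E), F.Finite ∧ F.Nonempty ∧ (∀ W ∈ F, W ≠ ⊥ ∧ W ≠ ⊤) ∧
      ∀ j, Submodule.map (A j : E →ₗ[ℝ] E) '' F = F := by
  classical
  have hAbij : ∀ j, Function.Bijective (A j : E →ₗ[ℝ] E) := by
    intro j
    obtain ⟨B, hB⟩ := (hA j).exists_left_inv
    have hinj : Function.Injective (A j : E →ₗ[ℝ] E) := by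
      refine Function.LeftInverse.injective (g := B) fun u => ?_
      exact congrArg (fun T : E →L[ℝ] E => T u) hB
    exact ⟨hinj, LinearMap.surjective_of_injective hinj⟩
  have hmap : ∀ j, ∀ W : Submodule ℝ E, (W.comap (A j : E →ₗ[ℝ] E)).map (A j : E →ₗ[ℝ] E) = W :=
    fun j W => Submodule.map_comap_eq_of_surjective (hAbij j).2 W
  have hrank : ∀ j, ∀ W : Submodule ℝ E,
      Module.finrank ℝ (W.comap (A j : E →ₗ[ℝ] E)) = Module.finrank ℝ W := by
    intro j W
    conv_rhs => rw [← hmap j W]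
    exact (LinearEquiv.finrank_map_eq (LinearEquiv.ofBijective _ (hAbij j)) _).symm
  have hmeas : ∀ W : Submodule ℝ E, MeasurableSet (W : Set E) :=
    fun W => W.closed_of_finiteDimensional.measurableSet
  -- a subspace of minimal dimension among the charged ones
  let p : ℕ → Prop := fun l => ∃ W : Submodule ℝ E, ∃ o, ν o W ≠ 0 ∧ Module.finrank ℝ W = l
  have hp : ∃ l, p l := ⟨_, W₀, o₀, hpos, rfl⟩
  obtain ⟨l, ⟨W₁, o₁, hW₁, hl⟩, hmin⟩ : ∃ l, p l ∧ ∀ m, m < l → ¬ p m :=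
    ⟨Nat.find hp, Nat.find_spec hp, fun m hm => Nat.find_min hp hm⟩
  have hl_lt : l < Module.finrank ℝ E := by
    refine lt_of_le_of_lt ?_ (Submodule.finrank_lt hW₀)
    by_contra! h
    exact hmin _ h ⟨W₀, o₀, hpos, rfl⟩
  have hbot : ∀ o, ν o ((⊥ : Submodule ℝ E) : Set E) = 0 := by
    intro o
    refine measure_mono_null ?_ (ae_iff.1 (hsph o))
    intro u hu
    have : u = 0 := by simpa using hu
    simp [this]
  -- The lower bound on the mass makes this set finite, so a largest mass is attained: distinct
  -- subspaces of the minimal dimension `l` meet in an uncharged one, hence are almost disjoint.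
  let T : Set (Option J × Submodule ℝ E) :=
    {x | Module.finrank ℝ x.2 = l ∧ ν o₁ W₁ ≤ ν x.1 x.2}
  have hTfin : T.Finite := by
    have h₁ : ∀ o, {W : {W : Submodule ℝ E // Module.finrank ℝ W = l} |
        ν o₁ W₁ ≤ ν o (W : Submodule ℝ E)}.Finite := by
      intro o
      have := hν o
      refine Measure.finite_const_le_meas_of_disjoint_iUnion₀ (ν o) (pos_iff_ne_zero.2 hW₁)
        (fun W => (hmeas W.1).nullMeasurableSet) (fun W W' hne => ?_) (measure_ne_top _ _)
      have hlt : W.1 ⊓ W'.1 < W.1 := by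
        refine lt_of_le_of_ne inf_le_left fun h => hne ?_
        exact Subtype.ext (Submodule.eq_of_le_of_finrank_eq (inf_eq_left.1 h)
          (W.2.trans W'.2.symm))
      by_contra h
      exact hmin _ ((Submodule.finrank_lt_finrank_of_lt hlt).trans_eq W.2)
        ⟨W.1 ⊓ W'.1, o, by simpa [AEDisjoint] using h, rfl⟩
    refine (Set.finite_iUnion fun o => (h₁ o).image fun W => (o, W.1)).subset ?_
    rintro ⟨o, W⟩ ⟨hd, hx⟩
    exact Set.mem_iUnion.2 ⟨o, ⟨W, hd⟩, hx, rfl⟩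
  obtain ⟨⟨o₂, W₂⟩, ⟨hd₂, hge₂⟩, hmax⟩ :=
    Set.exists_max_image T (fun x => ν x.1 x.2) hTfin ⟨(o₁, W₁), hl, le_rfl⟩
  have hle : ∀ o, ∀ W : Submodule ℝ E, Module.finrank ℝ W = l → ν o W ≤ ν o₂ W₂ := by
    intro o W hW
    by_cases h : ν o₁ W₁ ≤ ν o W
    · exact hmax (o, W) ⟨hW, h⟩
    · exact (not_le.1 h).le.trans hge₂
  let F : Set (Submodule ℝ E) := {W | Module.finrank ℝ W = l ∧ ∃ o, ν o W = ν o₂ W₂}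
  have hFfin : F.Finite := by
    refine (hTfin.image Prod.snd).subset ?_
    rintro W ⟨hW, o, ho⟩
    exact ⟨(o, W), ⟨hW, hge₂.trans_eq ho.symm⟩, rfl⟩
  have hcomap : ∀ j, ∀ W ∈ F, W.comap (A j : E →ₗ[ℝ] E) ∈ F := by
    rintro j W ⟨hW, o, ho⟩
    refine ⟨(hrank j W).trans hW, some j, ?_⟩
    -- Stationarity writes the maximal mass as an average, with positive weights, of masses not
    -- exceeding it. All of them are therefore maximal.
    have h₁ : ∑ j, q o j * (ν (some j)).real (W.comap (A j : E →ₗ[ℝ] E)) =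
        (ν o₂).real W₂ := by
      have h₂ := congrArg (fun m : Measure E => (m W).toReal) (hst o)
      simp only [transfer, Measure.coe_finsetSum, Finset.sum_apply, Measure.smul_apply,
        smul_eq_mul, Measure.map_apply (measurable_act _) (hmeas W), preimage_act_submodule,
        ho] at h₂
      rw [Measure.real, h₂, ENNReal.toReal_sum fun j _ => by have := hν (some j); finiteness]
      refine Finset.sum_congr rfl fun i _ => ?_
      rw [ENNReal.toReal_mul, ENNReal.toReal_ofReal (hq0 o i).le, Measure.real]
    have h₃ : ∀ i, (ν (some i)).real (W.comap (A i : E →ₗ[ℝ] E)) ≤ (ν o₂).real W₂ := by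
      intro i
      have := hν o₂
      exact ENNReal.toReal_mono (measure_ne_top _ _) (hle _ _ ((hrank i W).trans hW))
    have h₄ : ∑ i, q o i * (ν o₂).real W₂ = (ν o₂).real W₂ := by
      rw [← Finset.sum_mul, hq1, one_mul]
    have h₅ := (Finset.sum_eq_sum_iff_of_le
      fun i _ => mul_le_mul_of_nonneg_left (h₃ i) (hq0 o i).le).1 (h₁.trans h₄.symm) j
        (Finset.mem_univ j)
    have h₆ := mul_left_cancel₀ (hq0 o j).ne' h₅
    have := hν (some j)
    have := hν o₂
    exact (ENNReal.toReal_eq_toReal_iff' (measure_ne_top _ _) (measure_ne_top _ _)).1 h₆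
  have hcomap_inj : ∀ j, Function.Injective (Submodule.comap (A j : E →ₗ[ℝ] E)) := fun j =>
    Submodule.comap_injective_of_surjective (hAbij j).2
  -- An injective self-map of a finite set is onto.
  have hcomap_eq : ∀ j, Submodule.comap (A j : E →ₗ[ℝ] E) '' F = F := fun j =>
    Set.eq_of_subset_of_ncard_le (Set.image_subset_iff.2 (hcomap j))
      (Set.ncard_image_of_injective F (hcomap_inj j)).ge hFfin
  refine ⟨F, hFfin, ⟨W₂, hd₂, o₂, rfl⟩, ?_, fun j => ?_⟩
  · rintro W ⟨hW, o, ho⟩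
    have hW₂ : ν o W ≠ 0 := by rw [ho]; exact ne_bot_of_le_ne_bot hW₁ hge₂
    refine ⟨?_, ?_⟩
    · rintro rfl
      exact hW₂ (hbot o)
    · rintro rfl
      rw [finrank_top] at hW
      exact hl_lt.ne' hW
  · conv_lhs => rw [← hcomap_eq j, Set.image_image]
    simp [hmap]

end Proper

/-! ### Harmonic functions of the past and their martingales -/

section Probability

variable {Ω J : Type*}

/-- The word formed by the first `n` letters of the process `Y`, the latest letter coming first. -/
def past (Y : ℕ → Ω → J) : ℕ → Ω → List J
  | 0, _ => []
  | n + 1, ω => Y n ω :: past Y n ω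

lemma length_past (Y : ℕ → Ω → J) (n : ℕ) (ω : Ω) : (past Y n ω).length = n := by
  induction n with
  | zero => rfl
  | succ n ih => simp [past, ih]

lemma measurableSet_past_preimage [Finite J] [MeasurableSpace J] [MeasurableSingletonClass J]
    [MeasurableSpace Ω] {Y : ℕ → Ω → J} (hY : ∀ n, Measurable (Y n)) (n : ℕ) (B : Set (List J)) :
    MeasurableSet (past Y n ⁻¹' B) := by
  have h₁ : ∀ l, MeasurableSet {ω | past Y n ω = l} := by
    induction n with
    | zero => exact fun l => MeasurableSet.const ([] = l)
    | succ n ih =>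
      intro l
      cases l with
      | nil => simp [past]
      | cons j l =>
        have : {ω | past Y (n + 1) ω = j :: l} = Y n ⁻¹' {j} ∩ {ω | past Y n ω = l} := by
          ext ω; simp [past]
        rw [this]
        exact (hY n (measurableSet_singleton j)).inter (ih l)
  have h₂ : past Y n ⁻¹' B = ⋃ l ∈ B, {ω | past Y n ω = l} := by
    ext ω; simp
  rw [h₂]
  exact MeasurableSet.biUnion B.to_countable fun l _ => h₁ l

/-- The filtration generated by a process. -/
def pastFiltration [Finite J] [MeasurableSpace J] [MeasurableSingletonClass J]
    [mΩ : MeasurableSpace Ω] {Y : ℕ → Ω → J} (hY : ∀ n, Measurable (Y n)) :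
    Filtration ℕ mΩ where
  seq n := MeasurableSpace.comap (past Y n) ⊤
  mono' := by
    refine monotone_nat_of_le_succ fun n => ?_
    rintro _ ⟨B, -, rfl⟩
    exact ⟨List.tail ⁻¹' B, trivial, rfl⟩
  le' n := by
    rintro _ ⟨B, -, rfl⟩
    exact measurableSet_past_preimage hY n B

variable [Fintype J]

/-- The one-step averaging operator on functions of words. -/
def step (q : Option J → J → ℝ) (h : List J → ℝ) (l : List J) : ℝ :=
  ∑ j, q l.head? j * h (j :: l)

/-- Expand the square: `step` fixes constants and `h`. For `a = h l` the left side is the variance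
of `h` after `m` steps from `l`. -/
lemma iterate_step_sub_sq {q : Option J → J → ℝ} (hq1 : ∀ o, ∑ j, q o j = 1) {h : List J → ℝ}
    (hh : step q h = h) (a : ℝ) (m : ℕ) (l : List J) :
    (step q)^[m] (fun l => (h l - a) ^ 2) l =
      (step q)^[m] (fun l => h l ^ 2) l - 2 * a * h l + a ^ 2 := by
  induction m generalizing l with
  | zero => simp only [Function.iterate_zero, id]; ring
  | succ m ih =>
    rw [Function.iterate_succ_apply', Function.iterate_succ_apply']
    nth_rewrite 3 [← hh]
    simp only [step, ih]
    have h₁ : a ^ 2 = ∑ j, q l.head? j * a ^ 2 := by rw [← Finset.sum_mul, hq1, one_mul]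
    conv_rhs => rw [h₁, Finset.mul_sum, ← Finset.sum_sub_distrib, ← Finset.sum_add_distrib]
    exact Finset.sum_congr rfl fun j _ => by ring

/-- The path `g` is one of those averaged over, and its weight is at least `c ^ g.length`. -/
lemma pow_mul_le_iterate_step {q : Option J → J → ℝ} {c : ℝ} (hc : 0 ≤ c)
    (hq : ∀ o j, c ≤ q o j) {F : List J → ℝ} (hF : ∀ l, 0 ≤ F l) (g l : List J) :
    c ^ g.length * F (g ++ l) ≤ (step q)^[g.length] F l := by
  induction g generalizing F with
  | nil => simp
  | cons j g ih =>
    have h₂ : ∀ l, c * F (j :: l) ≤ step q F l := fun l =>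
      (mul_le_mul_of_nonneg_right (hq _ _) (hF _)).trans
        (Finset.single_le_sum (f := fun i => q l.head? i * F (i :: l))
          (fun i _ => mul_nonneg (hc.trans (hq _ _)) (hF _)) (Finset.mem_univ j))
    have h₃ : ∀ l, 0 ≤ step q F l := fun l => (mul_nonneg hc (hF _)).trans (h₂ l)
    rw [List.length_cons, Function.iterate_succ_apply, List.cons_append, pow_succ, mul_assoc]
    exact (mul_le_mul_of_nonneg_left (h₂ _) (pow_nonneg hc _)).trans (ih h₃)

variable [MeasurableSpace J] [MeasurableSingletonClass J] [MeasurableSpace Ω] {μ : Measure Ω}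
  [IsProbabilityMeasure μ] {Y : ℕ → Ω → J}

lemma measurable_past (hY : ∀ n, Measurable (Y n)) (h : List J → ℝ) (n : ℕ) :
    Measurable fun ω => h (past Y n ω) :=
  fun B _ => measurableSet_past_preimage hY n (h ⁻¹' B)

lemma integrable_past (hY : ∀ n, Measurable (Y n)) (h : List J → ℝ) (n : ℕ) :
    Integrable (fun ω => h (past Y n ω)) μ := by
  obtain ⟨C, hC⟩ := ((List.finite_length_eq J n).image fun l => |h l|).bddAbove
  exact Integrable.of_bound (measurable_past hY h n).aestronglyMeasurable C
    (ae_of_all _ fun ω => hC ⟨_, length_past Y n ω, rfl⟩)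

lemma integral_past (hY : ∀ n, Measurable (Y n)) (h : List J → ℝ) (n : ℕ) :
    ∫ ω, h (past Y n ω) ∂μ =
      ∑ l ∈ (List.finite_length_eq J n).toFinset, μ.real {ω | past Y n ω = l} * h l := by
  classical
  have h₁ : ∀ ω, h (past Y n ω) = ∑ l ∈ (List.finite_length_eq J n).toFinset,
      {ω | past Y n ω = l}.indicator (fun _ => h l) ω := by
    intro ω
    rw [Finset.sum_eq_single (past Y n ω)]
    · simp
    · intro l _ hl
      simp [hl.symm]
    · intro hn
      simp [length_past] at hn
  simp_rw [h₁]
  have h₂ : ∀ l, MeasurableSet {ω | past Y n ω = l} := fun l =>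
    measurableSet_past_preimage hY n {l}
  rw [integral_finsetSum _ fun l _ => (integrable_const _).indicator (h₂ l)]
  exact Finset.sum_congr rfl fun l _ => by rw [integral_indicator_const _ (h₂ l), smul_eq_mul]

/-- The process `Y` has transition weights `q`. -/
def HasTransitions (μ : Measure Ω) (Y : ℕ → Ω → J) (q : Option J → J → ℝ) : Prop :=
  ∀ n l j, μ.real {ω | past Y (n + 1) ω = j :: l} = q l.head? j * μ.real {ω | past Y n ω = l}

variable {q : Option J → J → ℝ}

lemma integral_past_succ (hY : ∀ n, Measurable (Y n)) (hlaw : HasTransitions μ Y q)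
    (h : List J → ℝ) (n : ℕ) :
    ∫ ω, h (past Y (n + 1) ω) ∂μ = ∫ ω, step q h (past Y n ω) ∂μ := by
  classical
  rw [integral_past hY, integral_past hY]
  simp only [step, Finset.mul_sum]
  rw [Finset.sum_comm, ← Finset.sum_product']
  refine (Finset.sum_bij (fun x _ => x.1 :: x.2) ?_ ?_ ?_ ?_).symm
  · rintro ⟨j, l⟩ hx
    simpa using hx
  · rintro ⟨j, l⟩ _ ⟨j', l'⟩ _ h
    simpa using h
  · rintro (_ | ⟨j, l⟩) hl
    · simp at hl
    · exact ⟨(j, l), by simpa using hl, rfl⟩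
  · rintro ⟨j, l⟩ _
    rw [hlaw n l j]
    ring

lemma integral_iterate_step (hY : ∀ n, Measurable (Y n)) (hlaw : HasTransitions μ Y q)
    (h : List J → ℝ) (m n : ℕ) :
    ∫ ω, (step q)^[m] h (past Y n ω) ∂μ = ∫ ω, h (past Y (n + m) ω) ∂μ := by
  induction m generalizing n with
  | zero => rfl
  | succ m ih =>
    simp_rw [Function.iterate_succ_apply']
    rw [← integral_past_succ hY hlaw, ih, add_right_comm, add_assoc]

/-- Bounded harmonic functions of words converge along almost every trajectory. -/
lemma ae_exists_tendsto_past (hY : ∀ n, Measurable (Y n)) (hlaw : HasTransitions μ Y q)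
    {h : List J → ℝ} (hh : step q h = h) {C : ℝ} (hC : ∀ l, |h l| ≤ C) :
    ∀ᵐ ω ∂μ, ∃ c, Tendsto (fun n => h (past Y n ω)) atTop (𝓝 c) := by
  have hmart : Martingale (fun n ω => h (past Y n ω)) (pastFiltration hY) μ := by
    refine martingale_of_setIntegral_eq_succ (fun n => ?_) (integrable_past hY h) ?_
    · refine Measurable.stronglyMeasurable ?_
      exact fun B _ => ⟨h ⁻¹' B, trivial, rfl⟩
    · rintro n _ ⟨B, -, rfl⟩
      classical
      have hB := measurableSet_past_preimage hY n B
      rw [← integral_indicator hB, ← integral_indicator hB]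
      -- An event about the first `n` letters is, at time `n + 1`, an event about the tail;
      -- averaging over the head leaves it untouched.
      have h₁ := integral_past_succ (μ := μ) hY hlaw (fun l => if l.tail ∈ B then h l else 0) n
      have h₂ : step q (fun l => if l.tail ∈ B then h l else 0) =
          fun l => if l ∈ B then h l else 0 := by
        ext l
        by_cases hl : l ∈ B
        · simp only [step, List.tail_cons, hl, if_true]
          exact congrFun hh l
        · simp [step, hl]
      rw [h₂] at h₁
      exact h₁.symm
  refine hmart.submartingale.exists_ae_tendsto_of_bdd (R := C.toNNReal) fun n => ?_
  refine (eLpNorm_le_of_ae_bound (ae_of_all _ fun ω => hC (past Y n ω))).trans ?_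
  simp [ENNReal.ofReal]

/-- A bounded harmonic function has asymptotically the same values along almost every trajectory
and along the trajectory continued by a fixed word. -/
lemma ae_tendsto_past_append (hq0 : ∀ o j, 0 < q o j) (hq1 : ∀ o, ∑ j, q o j = 1)
    (hY : ∀ n, Measurable (Y n)) (hlaw : HasTransitions μ Y q)
    {h : List J → ℝ} (hh : step q h = h) {C : ℝ} (hC : ∀ l, |h l| ≤ C) (g : List J) :
    ∀ᵐ ω ∂μ, Tendsto (fun n => h (g ++ past Y n ω) - h (past Y n ω)) atTop (𝓝 0) := by
  have hJ : Nonempty J := by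
    by_contra hJ
    rw [not_nonempty_iff] at hJ
    simpa using hq1 none
  obtain ⟨⟨o₁, j₁⟩, hmin⟩ := Finite.exists_min fun x : Option J × J => q x.1 x.2
  set c := q o₁ j₁ with hc_def
  have hc : 0 < c := hq0 _ _
  set m := g.length with hm
  -- The `m`-step conditional variance of `h`. It dominates the squared change along the single
  -- continuation `g`, up to the factor `c ^ m`.
  let s : List J → ℝ := fun l => (step q)^[m] (fun l => h l ^ 2) l - h l ^ 2
  have hs : ∀ l, c ^ m * (h (g ++ l) - h l) ^ 2 ≤ s l := by
    intro l
    have h₁ := pow_mul_le_iterate_step hc.le (fun o j => hmin (o, j))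
      (F := fun l' => (h l' - h l) ^ 2) (fun _ => sq_nonneg _) g l
    rw [iterate_step_sub_sq hq1 hh] at h₁
    refine h₁.trans_eq ?_
    simp only [s, hm]
    ring
  have hs0 : ∀ l, 0 ≤ s l := fun l => (by positivity : (0 : ℝ) ≤ _).trans (hs l)
  have hC2 : ∀ l, |h l ^ 2| ≤ C ^ 2 := fun l => by
    rw [abs_pow]
    exact pow_le_pow_left₀ (abs_nonneg _) (hC l) 2
  let e : ℕ → ℝ := fun n => ∫ ω, h (past Y n ω) ^ 2 ∂μ
  have he0 : ∀ n, 0 ≤ e n := fun n => integral_nonneg fun ω => sq_nonneg _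
  have heC : ∀ n, e n ≤ C ^ 2 := fun n => by
    have := norm_integral_le_of_norm_le_const (μ := μ) (f := fun ω => h (past Y n ω) ^ 2)
      (ae_of_all _ fun ω => hC2 (past Y n ω))
    simpa using (le_abs_self _).trans this
  have hes : ∀ n, ∫ ω, s (past Y n ω) ∂μ = e (n + m) - e n := by
    intro n
    refine Eq.trans ?_ (congrArg (· - e n)
      (integral_iterate_step hY hlaw (fun l => h l ^ 2) m n))
    exact integral_sub (integrable_past hY _ n) (integrable_past hY (fun l => h l ^ 2) n)
  -- The sum telescopes with gap `m`, leaving `m` terms at either end. Hence the conditional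
  -- variances are summable almost surely and tend to 0.
  have hsum : ∀ N, ∑ n ∈ Finset.range N, (e (n + m) - e n) ≤ m * C ^ 2 := by
    intro N
    have h₁ : ∑ n ∈ Finset.range N, e (n + m) + ∑ n ∈ Finset.range m, e n =
        ∑ n ∈ Finset.range N, e n + ∑ n ∈ Finset.range m, e (N + n) := by
      rw [← Finset.sum_range_add, add_comm N m, Finset.sum_range_add, add_comm]
      simp_rw [add_comm m]
    have h₂ : ∑ n ∈ Finset.range m, e (N + n) ≤ m * C ^ 2 := by
      simpa using Finset.sum_le_sum fun n (_ : n ∈ Finset.range m) => heC (N + n)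
    have h₃ : 0 ≤ ∑ n ∈ Finset.range m, e n := Finset.sum_nonneg fun n _ => he0 n
    rw [Finset.sum_sub_distrib]
    linarith
  have hlint : ∫⁻ ω, ∑' n, ENNReal.ofReal (s (past Y n ω)) ∂μ ≠ ⊤ := by
    rw [lintegral_tsum fun n => (measurable_past hY s n).ennreal_ofReal.aemeasurable]
    refine ne_top_of_le_ne_top (b := ENNReal.ofReal (m * C ^ 2)) ENNReal.ofReal_ne_top ?_
    refine ENNReal.tsum_le_of_sum_range_le fun N => ?_
    have h₁ : ∀ n, ∫⁻ ω, ENNReal.ofReal (s (past Y n ω)) ∂μ = ENNReal.ofReal (e (n + m) - e n) :=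
      fun n => by
        rw [← hes, ofReal_integral_eq_lintegral_ofReal (integrable_past hY s n)
          (ae_of_all _ fun ω => hs0 _)]
    simp_rw [h₁]
    rw [← ENNReal.ofReal_sum_of_nonneg fun n _ => by
      rw [← hes]; exact integral_nonneg fun ω => hs0 _]
    exact ENNReal.ofReal_le_ofReal (hsum N)
  filter_upwards [ae_lt_top (Measurable.tsum fun n =>
    (measurable_past hY s n).ennreal_ofReal) hlint] with ω hω
  have h₁ := ENNReal.tendsto_atTop_zero_of_tsum_ne_top hω.ne
  have h₂ : Tendsto (fun n => s (past Y n ω)) atTop (𝓝 0) := by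
    have := (ENNReal.tendsto_toReal ENNReal.zero_ne_top).comp h₁
    simpa [Function.comp_def, ENNReal.toReal_ofReal (hs0 _)] using this
  have h₃ : Tendsto (fun n => (h (g ++ past Y n ω) - h (past Y n ω)) ^ 2) atTop (𝓝 0) := by
    have h₄ : Tendsto (fun n => (c ^ m)⁻¹ * s (past Y n ω)) atTop (𝓝 0) := by
      simpa using h₂.const_mul (c ^ m)⁻¹
    refine squeeze_zero (fun n => sq_nonneg _) (fun n => ?_) h₄
    rw [le_inv_mul_iff₀ (pow_pos hc m)]
    exact hs _
  have h₅ := h₃.sqrt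
  simp_rw [Real.sqrt_sq_eq_abs, Real.sqrt_zero] at h₅
  exact (tendsto_zero_iff_abs_tendsto_zero _).2 h₅

end Probability

/-! ### Products along words and test functions -/

section WordProd

variable {E : Type*} [NormedAddCommGroup E] [InnerProductSpace ℝ E] {J : Type*}

/-- The product of the maps along a word, the head of the word being applied first. -/
def wordProd (A : J → E →L[ℝ] E) : List J → E →L[ℝ] E
  | [] => 1
  | j :: l => wordProd A l * A j

lemma wordProd_append (A : J → E →L[ℝ] E) (g l : List J) :
    wordProd A (g ++ l) = wordProd A l * wordProd A g := by
  induction g with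
  | nil => simp [wordProd]
  | cons j g ih => simp [wordProd, ih, mul_assoc]

lemma isUnit_wordProd {A : J → E →L[ℝ] E} (hA : ∀ j, IsUnit (A j)) (l : List J) :
    IsUnit (wordProd A l) := by
  induction l with
  | nil => exact isUnit_one
  | cons j l ih => exact ih.mul (hA j)

/-- No finite non-empty family of proper non-zero subspaces is permuted by the maps. -/
def NoFiniteInvariantFamily (A : J → E →L[ℝ] E) : Prop :=
  ¬ ∃ F : Set (Submodule ℝ E), F.Finite ∧ F.Nonempty ∧ (∀ W ∈ F, W ≠ ⊥ ∧ W ≠ ⊤) ∧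
      ∀ j, Submodule.map (A j : E →ₗ[ℝ] E) '' F = F

/-- Otherwise the span of the images of the range of `L` under all products lies in the kernel of
`R`. It is invariant, nonzero since `L ≠ 0` and proper since `R ≠ 0`, so it is an invariant family
with one member. -/
lemma exists_mul_wordProd_mul_ne_zero [FiniteDimensional ℝ E] {A : J → E →L[ℝ] E}
    (hA : ∀ j, IsUnit (A j)) (hirr : NoFiniteInvariantFamily A) {R L : E →L[ℝ] E} (hR : R ≠ 0)
    (hL : L ≠ 0) : ∃ g : List J, R * (wordProd A g * L) ≠ 0 := by
  by_contra! hzero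
  let W : Submodule ℝ E :=
    ⨆ g : List J, (LinearMap.range (L : E →ₗ[ℝ] E)).map (wordProd A g : E →ₗ[ℝ] E)
  have hmem : ∀ g u, wordProd A g (L u) ∈ W := fun g u =>
    Submodule.mem_iSup_of_mem g ⟨L u, ⟨u, rfl⟩, rfl⟩
  refine hirr ⟨{W}, Set.finite_singleton W, Set.singleton_nonempty W, ?_, fun j => ?_⟩
  · rintro _ rfl
    constructor
    · intro h
      apply hL
      ext1 u
      have := hmem [] u
      rw [h] at this
      simpa [wordProd] using this
    · intro h
      apply hR
      have hle : W ≤ LinearMap.ker (R : E →ₗ[ℝ] E) := by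
        refine iSup_le fun g => ?_
        rintro _ ⟨_, ⟨u, rfl⟩, rfl⟩
        exact congrArg (fun T : E →L[ℝ] E => T u) (hzero g)
      ext1 u
      exact hle (h ▸ Submodule.mem_top)
  · rw [Set.image_singleton]
    congr 1
    have hinj : Function.Injective (A j : E →ₗ[ℝ] E) := by
      obtain ⟨B, hB⟩ := (hA j).exists_left_inv
      exact Function.LeftInverse.injective (g := B) fun u =>
        congrArg (fun T : E →L[ℝ] E => T u) hB
    refine Submodule.eq_of_le_of_finrank_eq ?_
      (Submodule.equivMapOfInjective _ hinj W).finrank_eq.symm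
    rw [Submodule.map_iSup]
    refine iSup_le fun g => ?_
    rintro _ ⟨_, ⟨_, ⟨u, rfl⟩, rfl⟩, rfl⟩
    have := hmem (g ++ [j]) u
    rw [wordProd_append] at this
    simpa [wordProd] using this

lemma norm_eq_one_of_tendsto [Nontrivial E] {A : J → E →L[ℝ] E} {z : ℕ → List J} {R : E →L[ℝ] E}
    (hA : ∀ j, IsUnit (A j))
    (hR : Tendsto (fun n => ‖wordProd A (z n)‖⁻¹ • wordProd A (z n)) atTop (𝓝 R)) : ‖R‖ = 1 := by
  refine tendsto_nhds_unique hR.norm (tendsto_const_nhds.congr fun n => ?_)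
  rw [norm_smul, norm_inv, norm_norm,
    inv_mul_cancel₀ (norm_ne_zero_iff.2 (isUnit_wordProd hA _).ne_zero)]

/-- The measure integrated in `average` depends on the head of the word; as there are finitely many
states, it can be kept fixed along a subsequence. -/
lemma exists_subseq_head [Finite J] {A : J → E →L[ℝ] E} {z : ℕ → List J} {R : E →L[ℝ] E}
    (hR : MapClusterPt R atTop fun n =>
    ‖wordProd A (z n)‖⁻¹ • wordProd A (z n)) :
    ∃ (θ : ℕ → ℕ) (o : Option J), StrictMono θ ∧ (∀ n, (z (θ n)).head? = o) ∧
      Tendsto (fun n => ‖wordProd A (z (θ n))‖⁻¹ • wordProd A (z (θ n))) atTop (𝓝 R) := by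
  obtain ⟨θ, hθ, hlim⟩ := hR.tendsto_subseq
  obtain ⟨o, ho⟩ : ∃ o, ∃ᶠ n in atTop, (z (θ n)).head? = o := by
    by_contra! h
    have h' : ∀ᶠ n in atTop, ∀ o, (z (θ n)).head? ≠ o :=
      eventually_all.2 h
    obtain ⟨n, hn⟩ := h'.exists
    exact hn _ rfl
  obtain ⟨ξ, hξ, hξo⟩ := extraction_of_frequently_atTop ho
  exact ⟨θ ∘ ξ, o, hθ.comp hξ, hξo, hlim.comp hξ.tendsto_atTop⟩

/-- A tent function of the distance to the hyperplane orthogonal to `x`. -/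
def tent (x : E) (p : ℕ) (v : E) : ℝ := max 0 (1 - p * (inner ℝ x v) ^ 2)

lemma continuous_tent (x : E) (p : ℕ) : Continuous (tent x p) := by
  unfold tent
  fun_prop

lemma tent_nonneg (x : E) (p : ℕ) (v : E) : 0 ≤ tent x p v := le_max_left _ _

lemma tent_le_one (x : E) (p : ℕ) (v : E) : tent x p v ≤ 1 :=
  max_le zero_le_one (sub_le_self _ (by positivity))

lemma abs_tent_le_one (x : E) (p : ℕ) (v : E) : |tent x p v| ≤ 1 := by
  rw [abs_of_nonneg (tent_nonneg x p v)]
  exact tent_le_one x p v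

lemma tendsto_tent {x v : E} (h : inner ℝ x v ≠ 0) :
    Tendsto (fun p => tent x p v) atTop (𝓝 0) := by
  have h₁ : Tendsto (fun p : ℕ => (p : ℝ) * (inner ℝ x v) ^ 2) atTop atTop :=
    tendsto_natCast_atTop_atTop.atTop_mul_const (by positivity)
  refine tendsto_const_nhds.congr' ?_
  filter_upwards [h₁.eventually_ge_atTop 1] with p hp
  exact (max_eq_left (by linarith)).symm

lemma exists_bound_of_continuous [FiniteDimensional ℝ E] {f : E → ℝ} (hf : Continuous f) :
    ∃ C, ∀ T : E →L[ℝ] E, ∀ u, |f (act T u)| ≤ C := by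
  have := FiniteDimensional.proper_real E
  obtain ⟨C, hC⟩ := (isCompact_closedBall (0 : E) 1).exists_bound_of_continuousOn hf.continuousOn
  exact ⟨C, fun T u => hC _ (by simpa using norm_act_le T u)⟩

/-- The product of two coordinate functions. -/
def coordMul (E : Type*) [NormedAddCommGroup E] [InnerProductSpace ℝ E] [FiniteDimensional ℝ E]
    (a : Fin (Module.finrank ℝ E) × Fin (Module.finrank ℝ E)) (v : E) : ℝ :=
  inner ℝ (stdOrthonormalBasis ℝ E a.1) v * inner ℝ (stdOrthonormalBasis ℝ E a.2) v

lemma continuous_coordMul [FiniteDimensional ℝ E] (a) : Continuous (coordMul E a) := by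
  unfold coordMul
  fun_prop

end WordProd

/-! ### Proper measures see the range of a linear map -/

section Proper

variable {E : Type*} [NormedAddCommGroup E] [InnerProductSpace ℝ E] [MeasurableSpace E]

/-- A measure is proper if it does not charge any proper subspace. -/
def IsProper (m : Measure E) : Prop := ∀ W : Submodule ℝ E, W ≠ ⊤ → m W = 0

lemma IsProper.ae_ne_zero {m : Measure E} (hm : IsProper m) {T : E →L[ℝ] E} (hT : T ≠ 0) :
    ∀ᵐ u ∂m, T u ≠ 0 := by
  refine measure_mono_null (fun u hu => ?_) (hm (LinearMap.ker (T : E →ₗ[ℝ] E)) fun h => hT ?_)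
  · simpa using hu
  · ext1 u
    exact (h ▸ Submodule.mem_top : u ∈ LinearMap.ker (T : E →ₗ[ℝ] E))

lemma IsProper.ae_inner_ne_zero {m : Measure E} (hm : IsProper m) {x : E} (hx : x ≠ 0) :
    ∀ᵐ u ∂m, inner ℝ x u ≠ 0 := by
  refine measure_mono_null (fun u hu => ?_) (hm (ℝ ∙ x)ᗮ fun h => hx ?_)
  · simpa [Submodule.mem_orthogonal_singleton_iff_inner_right] using hu
  · simpa [Submodule.orthogonal_eq_top_iff] using h

variable [FiniteDimensional ℝ E] [BorelSpace E]

lemma integrable_comp_act {f : E → ℝ} (hf : Continuous f) (T : E →L[ℝ] E) (m : Measure E)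
    [IsFiniteMeasure m] : Integrable (fun u => f (act T u)) m := by
  obtain ⟨C, hC⟩ := exists_bound_of_continuous hf
  exact Integrable.of_bound (hf.measurable.comp (measurable_act T)).aestronglyMeasurable C
    (ae_of_all _ fun u => hC T u)

/-- Normalisation can fail to be continuous in the limit only on the kernel of `S`, which is a null
set; elsewhere dominated convergence applies. -/
lemma IsProper.tendsto_integral_act {m : Measure E} [IsFiniteMeasure m] (hm : IsProper m)
    {f : E → ℝ} (hf : Continuous f) {T : ℕ → E →L[ℝ] E} {S : E →L[ℝ] E} (hS : S ≠ 0)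
    (hT : Tendsto T atTop (𝓝 S)) :
    Tendsto (fun n => ∫ u, f (act (T n) u) ∂m) atTop (𝓝 (∫ u, f (act S u) ∂m)) := by
  obtain ⟨C, hC⟩ := exists_bound_of_continuous hf
  refine tendsto_integral_of_dominated_convergence (fun _ => C)
    (fun n => (integrable_comp_act hf (T n) m).aestronglyMeasurable) (integrable_const C)
    (fun n => ae_of_all _ fun u => hC _ u) ?_
  filter_upwards [hm.ae_ne_zero hS] with u hu
  have h : Tendsto (fun n => T n u) atTop (𝓝 (S u)) :=
    ((ContinuousLinearMap.apply ℝ E u).continuous.tendsto S).comp hT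
  exact (hf.tendsto _).comp ((h.norm.inv₀ (norm_ne_zero_iff.2 hu)).smul h)

/-- If the integral vanishes, almost every `u` is orthogonal to the adjoint image of `x`. A proper
measure allows this only if that image is zero. -/
lemma IsProper.integral_inner_act_sq_eq_zero_iff {m : Measure E} [IsProbabilityMeasure m]
    (hm : IsProper m) (T : E →L[ℝ] E) (x : E) :
    ∫ u, (inner ℝ x (act T u)) ^ 2 ∂m = 0 ↔ x ∈ (LinearMap.range (T : E →ₗ[ℝ] E))ᗮ := by
  have hx : x ∈ (LinearMap.range (T : E →ₗ[ℝ] E))ᗮ ↔ ∀ u, inner ℝ x (T u) = 0 := by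
    simp [Submodule.mem_orthogonal']
  rw [hx, integral_eq_zero_iff_of_nonneg (fun u => sq_nonneg _)
    (integrable_comp_act (f := fun v => (inner ℝ x v) ^ 2) (by fun_prop) T m)]
  constructor
  · intro h
    by_contra! hne
    have := FiniteDimensional.complete ℝ E
    have hadj : T.adjoint x ≠ 0 := by
      obtain ⟨u, hu⟩ := hne
      rintro h0
      rw [← ContinuousLinearMap.adjoint_inner_left, h0, inner_zero_left] at hu
      exact hu rfl
    obtain ⟨u, h₁, h₂⟩ := (h.and (hm.ae_inner_ne_zero hadj)).exists
    rw [ContinuousLinearMap.adjoint_inner_left] at h₂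
    have h₃ : ‖T u‖⁻¹ ≠ 0 := by
      rw [ne_eq, inv_eq_zero, norm_eq_zero]
      rintro h0
      simp [h0] at h₂
    have h₁' : (inner ℝ x (act T u)) ^ 2 = 0 := h₁
    simp only [act, inner_smul_right] at h₁'
    exact (pow_ne_zero 2 (mul_ne_zero h₃ h₂)) h₁'
  · intro h
    exact ae_of_all _ fun u => by simp [act, inner_smul_right, h u]

lemma IsProper.range_eq_range {m m' : Measure E} [IsProbabilityMeasure m]
    [IsProbabilityMeasure m'] (hm : IsProper m) (hm' : IsProper m') {T T' : E →L[ℝ] E}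
    (h : ∀ x : E, ∫ u, (inner ℝ x (act T u)) ^ 2 ∂m = ∫ u, (inner ℝ x (act T' u)) ^ 2 ∂m') :
    LinearMap.range (T : E →ₗ[ℝ] E) = LinearMap.range (T' : E →ₗ[ℝ] E) := by
  rw [← Submodule.orthogonal_orthogonal (LinearMap.range (T : E →ₗ[ℝ] E)),
    ← Submodule.orthogonal_orthogonal (LinearMap.range (T' : E →ₗ[ℝ] E))]
  congr 1
  ext x
  rw [← hm.integral_inner_act_sq_eq_zero_iff, ← hm'.integral_inner_act_sq_eq_zero_iff, h x]

/-- The second moments in all directions are combinations of finitely many coordinate ones, so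
finitely many martingales suffice. -/
lemma IsProper.range_eq_range_of_coordMul {m m' : Measure E} [IsProbabilityMeasure m]
    [IsProbabilityMeasure m'] (hm : IsProper m) (hm' : IsProper m') {T T' : E →L[ℝ] E}
    (h : ∀ a, ∫ u, coordMul E a (act T u) ∂m = ∫ u, coordMul E a (act T' u) ∂m') :
    LinearMap.range (T : E →ₗ[ℝ] E) = LinearMap.range (T' : E →ₗ[ℝ] E) := by
  have key : ∀ (m : Measure E) [IsProbabilityMeasure m] (T : E →L[ℝ] E) (x : E),
      ∫ u, (inner ℝ x (act T u)) ^ 2 ∂m =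
        ∑ a : Fin (Module.finrank ℝ E) × Fin (Module.finrank ℝ E),
          (inner ℝ x (stdOrthonormalBasis ℝ E a.1) * inner ℝ x (stdOrthonormalBasis ℝ E a.2)) *
            ∫ u, coordMul E a (act T u) ∂m := by
    intro m _ T x
    simp_rw [← integral_const_mul]
    rw [← integral_finsetSum _ fun a _ =>
      (integrable_comp_act (continuous_coordMul a) T m).const_mul _]
    refine integral_congr_ae (ae_of_all _ fun u => ?_)
    simp only
    rw [← (stdOrthonormalBasis ℝ E).sum_inner_mul_inner x (act T u), sq, Finset.sum_mul_sum,
      ← Finset.sum_product']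
    exact Finset.sum_congr rfl fun a _ => by simp only [coordMul]; ring
  exact hm.range_eq_range hm' fun x => by simp_rw [key, h]

end Proper

/-! ### Averages against a proper stationary family -/

variable {E : Type*} [NormedAddCommGroup E] [InnerProductSpace ℝ E] [MeasurableSpace E]
  {J : Type*} [Fintype J]

/-- A stationary family of proper probability measures. -/
structure IsProperStationary (q : Option J → J → ℝ) (A : J → E →L[ℝ] E)
    (ν : Option J → Measure E) : Prop where
  prob : ∀ o, IsProbabilityMeasure (ν o)
  proper : ∀ o, IsProper (ν o)
  stationary : ∀ o, ν o = transfer q (fun j => act (A j)) ν o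

/-- The integral of `f` with respect to the image of a stationary measure under the product along
a word. -/
def average (A : J → E →L[ℝ] E) (ν : Option J → Measure E) (f : E → ℝ) (l : List J) : ℝ :=
  ∫ u, f (act (wordProd A l) u) ∂(ν l.head?)

variable {q : Option J → J → ℝ} {A : J → E →L[ℝ] E} {ν : Option J → Measure E}

lemma abs_average_le (hν : IsProperStationary q A ν) {f : E → ℝ} {C : ℝ}
    (hC : ∀ T : E →L[ℝ] E, ∀ u, |f (act T u)| ≤ C) (l : List J) : |average A ν f l| ≤ C := by
  have := hν.prob l.head?
  have h := norm_integral_le_of_norm_le_const (μ := ν l.head?)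
    (f := fun u => f (act (wordProd A l) u)) (ae_of_all _ fun u => hC _ u)
  simpa [average] using h

variable [FiniteDimensional ℝ E] [BorelSpace E]

lemma exists_isProperStationary [Nontrivial E] (hq0 : ∀ o j, 0 < q o j)
    (hq1 : ∀ o, ∑ j, q o j = 1) (hA : ∀ j, IsUnit (A j)) (hirr : NoFiniteInvariantFamily A) :
    ∃ ν, IsProperStationary q A ν := by
  obtain ⟨ν, hν, hsph, hst⟩ := exists_stationary (fun o j => (hq0 o j).le) hq1 hA
  refine ⟨ν, hν, fun o W hW => ?_, hst⟩
  by_contra h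
  exact hirr (exists_finite_invariant_family hq0 hq1 hA hν hsph hst W hW o h)

/-- This is stationarity in state `l.head?`: the head of a word acts first, so a new letter acts
directly on the measure. -/
lemma step_average (hq0 : ∀ o j, 0 ≤ q o j) (hν : IsProperStationary q A ν) {f : E → ℝ}
    (hf : Continuous f) : step q (average A ν f) = average A ν f := by
  ext l
  obtain ⟨C, hC⟩ := exists_bound_of_continuous hf
  have h₁ := integral_transfer (f := fun u => f (act (wordProd A l) u)) hq0
    (fun j => measurable_act (A j)) hν.prob (hf.measurable.comp (measurable_act _))
    (fun j u => hC _ _) l.head?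
  rw [← hν.stationary] at h₁
  rw [average, h₁, step]
  simp only [average, List.head?_cons, wordProd, act_mul]

lemma exists_mapClusterPt_normalize {F : Type*} [NormedAddCommGroup F] [NormedSpace ℝ F]
    [FiniteDimensional ℝ F] (N : ℕ → F) :
    ∃ R, MapClusterPt R atTop fun n => ‖N n‖⁻¹ • N n := by
  have := FiniteDimensional.proper_real F
  obtain ⟨R, -, hR⟩ := (isCompact_closedBall (0 : F) 1).exists_mapClusterPt
    (u := fun n => ‖N n‖⁻¹ • N n) (f := atTop)
    (tendsto_principal.2 <| Eventually.of_forall fun n => by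
      simp only [mem_closedBall_zero_iff, norm_smul, norm_inv, norm_norm]
      exact inv_mul_le_one)
  exact ⟨R, hR⟩

/-! ### Ranges and ranks of limit points -/

section LimitPoints

variable {z : ℕ → List J} {R : E →L[ℝ] E}

/-- Prepending `g` multiplies by its product on the right. The limit stays nonzero because `R` has
norm one and that product is invertible. -/
lemma tendsto_average_append [Nontrivial E] (hA : ∀ j, IsUnit (A j))
    (hν : IsProperStationary q A ν) {f : E → ℝ} (hf : Continuous f)
    (hR : Tendsto (fun n => ‖wordProd A (z n)‖⁻¹ • wordProd A (z n)) atTop (𝓝 R)) (g : List J)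
    {o : Option J} (ho : ∀ n, (g ++ z n).head? = o) :
    Tendsto (fun n => average A ν f (g ++ z n)) atTop
      (𝓝 (∫ u, f (act (R * wordProd A g) u) ∂(ν o))) := by
  have := hν.prob o
  have hR0 : R ≠ 0 := fun h => by simpa [h] using norm_eq_one_of_tendsto hA hR
  have hne : R * wordProd A g ≠ 0 := fun h =>
    hR0 ((isUnit_wordProd hA g).mul_left_eq_zero.1 h)
  refine ((hν.proper o).tendsto_integral_act hf hne (hR.mul_const _)).congr fun n => ?_
  have hpos : 0 < ‖wordProd A (z n)‖⁻¹ :=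
    inv_pos.2 (norm_pos_iff.2 (isUnit_wordProd hA _).ne_zero)
  simp only [average, ho n, wordProd_append, smul_mul_assoc, act_smul hpos]

/-- The words `z n` are generic: the averages of all coordinate products converge, and the limits
do not change when a fixed word is prepended. -/
def IsGeneric (A : J → E →L[ℝ] E) (ν : Option J → Measure E) (z : ℕ → List J) : Prop :=
  ∀ a, (∃ c, Tendsto (fun n => average A ν (coordMul E a) (z n)) atTop (𝓝 c)) ∧
    ∀ g, Tendsto (fun n => average A ν (coordMul E a) (g ++ z n) -
      average A ν (coordMul E a) (z n)) atTop (𝓝 0)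

lemma IsGeneric.range_eq [Nontrivial E] (hz : IsGeneric A ν z) (hA : ∀ j, IsUnit (A j))
    (hν : IsProperStationary q A ν) {R' : E →L[ℝ] E}
    (hR : MapClusterPt R atTop fun n => ‖wordProd A (z n)‖⁻¹ • wordProd A (z n))
    (hR' : MapClusterPt R' atTop fun n => ‖wordProd A (z n)‖⁻¹ • wordProd A (z n)) :
    LinearMap.range (R : E →ₗ[ℝ] E) = LinearMap.range (R' : E →ₗ[ℝ] E) := by
  obtain ⟨θ, o, hθ, ho, hlim⟩ := exists_subseq_head hR
  obtain ⟨θ', o', hθ', ho', hlim'⟩ := exists_subseq_head hR'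
  have := hν.prob o
  have := hν.prob o'
  refine (hν.proper o).range_eq_range_of_coordMul (hν.proper o') fun a => ?_
  obtain ⟨⟨c, hc⟩, -⟩ := hz a
  have h₁ := tendsto_average_append hA hν (continuous_coordMul a) hlim [] ho
  have h₂ := tendsto_average_append hA hν (continuous_coordMul a) hlim' [] ho'
  simp only [wordProd, mul_one, List.nil_append] at h₁ h₂
  rw [tendsto_nhds_unique h₁ (hc.comp hθ.tendsto_atTop),
    tendsto_nhds_unique h₂ (hc.comp hθ'.tendsto_atTop)]

/-- Genericity gives `R` and every extension of it by a word the same second moments. Letting the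
word follow `w n` and normalising, this passes to a nonzero map that factors through `L`. -/
lemma IsGeneric.finrank_range_le [Nontrivial E] [Nonempty J] (hz : IsGeneric A ν z)
    (hA : ∀ j, IsUnit (A j)) (hirr : NoFiniteInvariantFamily A)
    (hν : IsProperStationary q A ν) {w : ℕ → List J} {L : E →L[ℝ] E}
    (hL : Tendsto (fun n => ‖wordProd A (w n)‖⁻¹ • wordProd A (w n)) atTop (𝓝 L))
    (hR : MapClusterPt R atTop fun n => ‖wordProd A (z n)‖⁻¹ • wordProd A (z n)) :
    Module.finrank ℝ (LinearMap.range (R : E →ₗ[ℝ] E)) ≤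
      Module.finrank ℝ (LinearMap.range (L : E →ₗ[ℝ] E)) := by
  obtain ⟨θ, o, hθ, ho, hlim⟩ := exists_subseq_head hR
  have hR0 : R ≠ 0 := fun h => by simpa [h] using norm_eq_one_of_tendsto hA hlim
  have hL0 : L ≠ 0 := fun h => by simpa [h] using norm_eq_one_of_tendsto hA hL
  obtain ⟨g, hg⟩ := exists_mul_wordProd_mul_ne_zero hA hirr hR0 hL0
  let j : J := Classical.arbitrary J
  let T : E →L[ℝ] E := R * (wordProd A g * L) * A j
  have hT : T ≠ 0 := fun h => hg ((hA j).mul_left_eq_zero.1 h)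
  have := hν.prob o
  have := hν.prob (some j)
  have hrange : LinearMap.range (R : E →ₗ[ℝ] E) = LinearMap.range (T : E →ₗ[ℝ] E) := by
    refine (hν.proper o).range_eq_range_of_coordMul (hν.proper (some j)) fun a => ?_
    obtain ⟨⟨c, hc⟩, happ⟩ := hz a
    have h₁ := tendsto_average_append hA hν (continuous_coordMul a) hlim [] ho
    simp only [wordProd, mul_one, List.nil_append] at h₁
    rw [tendsto_nhds_unique h₁ (hc.comp hθ.tendsto_atTop)]
    have h₂ : ∀ n, ∫ u, coordMul E a (act (R * (wordProd A g * wordProd A (w n)) * A j) u)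
        ∂(ν (some j)) = c := by
      intro n
      -- The extra head `j` fixes the state, hence the measure, independently of `n`.
      have h₃ := tendsto_average_append hA hν (continuous_coordMul a) hlim (j :: (w n ++ g))
        (o := some j) fun _ => rfl
      have h₄ : Tendsto (fun k => average A ν (coordMul E a) (j :: (w n ++ g) ++ z k)) atTop
          (𝓝 c) := by
        simpa using (happ (j :: (w n ++ g))).add hc
      have h₅ := tendsto_nhds_unique h₃ (h₄.comp hθ.tendsto_atTop)
      rwa [wordProd, wordProd_append, ← mul_assoc R] at h₅
    have h₆ := (hν.proper (some j)).tendsto_integral_act (continuous_coordMul a) hT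
      (((hL.const_mul (wordProd A g)).const_mul R).mul_const (A j))
    refine tendsto_nhds_unique (tendsto_const_nhds.congr fun n => ?_) h₆
    have hpos : 0 < ‖wordProd A (w n)‖⁻¹ :=
      inv_pos.2 (norm_pos_iff.2 (isUnit_wordProd hA _).ne_zero)
    simp only [mul_smul_comm, smul_mul_assoc, act_smul hpos]
    exact (h₂ n).symm
  rw [hrange]
  have h₁ : (T : E →ₗ[ℝ] E) = ((R * wordProd A g : E →L[ℝ] E) : E →ₗ[ℝ] E) ∘ₗ
      ((L : E →ₗ[ℝ] E) ∘ₗ (A j : E →ₗ[ℝ] E)) := by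
    ext u
    rfl
  rw [h₁, LinearMap.range_comp]
  exact (Submodule.finrank_map_le _ _).trans
    (Submodule.finrank_mono (LinearMap.range_comp_le_range _ _))

end LimitPoints

/-! ### Almost sure statements for the random products -/

variable [MeasurableSpace J] [MeasurableSingletonClass J] {Ω : Type*} [MeasurableSpace Ω]
  {μ : Measure Ω} [IsProbabilityMeasure μ] {Y : ℕ → Ω → J}

lemma ae_isGeneric (hq0 : ∀ o j, 0 < q o j) (hq1 : ∀ o, ∑ j, q o j = 1)
    (hY : ∀ n, Measurable (Y n)) (hlaw : HasTransitions μ Y q)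
    (hν : IsProperStationary q A ν) : ∀ᵐ ω ∂μ, IsGeneric A ν fun n => past Y n ω := by
  unfold IsGeneric
  refine ae_all_iff.2 fun a => ?_
  obtain ⟨C, hC⟩ := exists_bound_of_continuous (continuous_coordMul (E := E) a)
  have hstep := step_average (fun o j => (hq0 o j).le) hν (continuous_coordMul (E := E) a)
  have hle := abs_average_le hν hC
  filter_upwards [ae_exists_tendsto_past hY hlaw hstep hle, ae_all_iff.2 fun g =>
    ae_tendsto_past_append hq0 hq1 hY hlaw hstep hle g] with ω h₁ h₂
  exact ⟨h₁, h₂⟩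

/-- Almost surely, no limit point of the normalised products has range orthogonal to `x`. -/
lemma measure_inner_range_eq_zero [Nontrivial E] (hA : ∀ j, IsUnit (A j))
    (hq0 : ∀ o j, 0 < q o j) (hY : ∀ n, Measurable (Y n))
    (hlaw : HasTransitions μ Y q) (hν : IsProperStationary q A ν) {x : E} (hx : x ≠ 0) :
    μ {ω | ∃ R : E →L[ℝ] E, (MapClusterPt R atTop fun n =>
      ‖wordProd A (past Y n ω)‖⁻¹ • wordProd A (past Y n ω)) ∧ ∀ u, inner ℝ x (R u) = 0} = 0 := by
  set D : Set Ω := _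
  change μ D = 0
  have hle : ∀ p, μ D ≤ ENNReal.ofReal (average A ν (tent x p) []) := by
    intro p
    let h : List J → ℝ := average A ν (tent x p)
    have hh : step q h = h := step_average (fun o j => (hq0 o j).le) hν (continuous_tent x p)
    have hC : ∀ l, |h l| ≤ 1 := abs_average_le hν fun T u => abs_tent_le_one x p _
    have h0 : ∀ l, 0 ≤ h l := fun l => integral_nonneg fun u => tent_nonneg x p _
    let G : Ω → ENNReal := fun ω => liminf (fun n => ENNReal.ofReal (h (past Y n ω))) atTop
    have hmeas : ∀ n, Measurable fun ω => ENNReal.ofReal (h (past Y n ω)) := fun n =>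
      (measurable_past hY h n).ennreal_ofReal
    have hint : ∀ n, ∫ ω, h (past Y n ω) ∂μ = h [] := by
      intro n
      induction n with
      | zero => simp [past]
      | succ n ih => rw [integral_past_succ hY hlaw, hh, ih]
    -- On `D` the tent equals 1 on the whole range of `R`, so the martingale has limit 1 there.
    -- Using its liminf gives a measurable majorant without measurability of `D`.
    have hD : D ≤ᵐ[μ] {ω | 1 ≤ G ω} := by
      filter_upwards [ae_exists_tendsto_past hY hlaw hh hC] with ω hω hωD
      obtain ⟨c, hc⟩ := hω
      obtain ⟨R, hR, hRx⟩ := hωD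
      obtain ⟨θ, o, hθ, ho, hlim⟩ := exists_subseq_head hR
      have := hν.prob o
      have h₁ := tendsto_average_append hA hν (continuous_tent x p) hlim [] ho
      have h₂ : ∀ u, tent x p (act (R * wordProd A []) u) = 1 := fun u => by
        simp [tent, act, wordProd, inner_smul_right, hRx]
      simp only [h₂, List.nil_append] at h₁
      have h₃ : c = 1 := by
        simpa using tendsto_nhds_unique (hc.comp hθ.tendsto_atTop) h₁
      have h₄ := (ENNReal.continuous_ofReal.tendsto c).comp hc
      have h₅ : G ω = ENNReal.ofReal c := h₄.liminf_eq
      change 1 ≤ G ω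
      rw [h₅, h₃, ENNReal.ofReal_one]
    calc μ D ≤ μ {ω | 1 ≤ G ω} := measure_mono_ae hD
      _ ≤ ∫⁻ ω, G ω ∂μ := by
        simpa using mul_meas_ge_le_lintegral (μ := μ) (Measurable.liminf hmeas) 1
      _ ≤ liminf (fun n => ∫⁻ ω, ENNReal.ofReal (h (past Y n ω)) ∂μ) atTop :=
        lintegral_liminf_le hmeas
      _ = ENNReal.ofReal (h []) := by
        simp_rw [← ofReal_integral_eq_lintegral_ofReal (integrable_past hY h _)
          (ae_of_all _ fun ω => h0 _), hint]
        exact liminf_const _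
  -- As `p` grows the tents shrink to the hyperplane orthogonal to `x`, which `ν none` does not
  -- charge.
  have hlim : Tendsto (fun p => average A ν (tent x p) []) atTop (𝓝 0) := by
    have : IsProbabilityMeasure (ν ([] : List J).head?) := hν.prob none
    have h₁ : Tendsto (fun p => average A ν (tent x p) []) atTop (𝓝 (∫ _, (0 : ℝ) ∂(ν none))) := by
      refine tendsto_integral_of_dominated_convergence (fun _ => 1)
        (fun p => (integrable_comp_act (continuous_tent x p) _ _).aestronglyMeasurable)
        (integrable_const 1) (fun p => ae_of_all _ fun u => abs_tent_le_one x p _) ?_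
      filter_upwards [(hν.proper none).ae_inner_ne_zero hx] with u hu
      refine tendsto_tent ?_
      have hu0 : u ≠ 0 := by rintro rfl; simp at hu
      simpa [act, wordProd, inner_smul_right, hu0] using hu
    simpa using h₁
  have := ge_of_tendsto' ((ENNReal.continuous_ofReal.tendsto 0).comp hlim) hle
  simpa using this

/-- The range of the limit points of products of random matrices. -/
theorem exists_limit_range [Nontrivial E] (hA : ∀ j, IsUnit (A j))
    (hirr : NoFiniteInvariantFamily A) (hq0 : ∀ o j, 0 < q o j) (hq1 : ∀ o, ∑ j, q o j = 1)
    (hY : ∀ n, Measurable (Y n)) (hlaw : HasTransitions μ Y q) {r : ℕ}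
    (hr : ∃ (w : ℕ → List J) (L : E →L[ℝ] E),
      Tendsto (fun n => ‖wordProd A (w n)‖⁻¹ • wordProd A (w n)) atTop (𝓝 L) ∧
        Module.finrank ℝ (LinearMap.range (L : E →ₗ[ℝ] E)) = r)
    (hmin : ∀ (w : ℕ → List J) (L : E →L[ℝ] E),
      Tendsto (fun n => ‖wordProd A (w n)‖⁻¹ • wordProd A (w n)) atTop (𝓝 L) →
        r ≤ Module.finrank ℝ (LinearMap.range (L : E →ₗ[ℝ] E))) :
    ∃ V : Ω → Submodule ℝ E,
      (∀ᵐ ω ∂μ, Module.finrank ℝ (V ω) = r ∧ ∀ R : E →L[ℝ] E,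
        (MapClusterPt R atTop fun n =>
          ‖wordProd A (past Y n ω)‖⁻¹ • wordProd A (past Y n ω)) →
            LinearMap.range (R : E →ₗ[ℝ] E) = V ω) ∧
      ∀ x : E, x ≠ 0 → μ {ω | x ∈ (V ω)ᗮ} = 0 := by
  have hJ : Nonempty J := by
    by_contra hJ
    rw [not_nonempty_iff] at hJ
    simpa using hq1 none
  obtain ⟨ν, hν⟩ := exists_isProperStationary hq0 hq1 hA hirr
  choose R hR using fun ω =>
    exists_mapClusterPt_normalize fun n => wordProd A (past Y n ω)
  refine ⟨fun ω => LinearMap.range (R ω : E →ₗ[ℝ] E), ?_, fun x hx => ?_⟩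
  · filter_upwards [ae_isGeneric hq0 hq1 hY hlaw hν] with ω hω
    refine ⟨?_, fun R' hR' => hω.range_eq hA hν hR' (hR ω)⟩
    obtain ⟨w, L, hL, rfl⟩ := hr
    refine le_antisymm (hω.finrank_range_le hA hirr hν hL (hR ω)) ?_
    obtain ⟨θ, -, -, -, hθ⟩ := exists_subseq_head (hR ω)
    exact hmin _ _ hθ
  · refine measure_mono_null (fun ω hω => ?_)
      (measure_inner_range_eq_zero hA hq0 hY hlaw hν hx)
    refine ⟨R ω, hR ω, fun u => ?_⟩
    exact (Submodule.mem_orthogonal' _ _).1 hω _ ⟨u, rfl⟩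

/-! ### Words of one-sided and two-sided sequences -/

section Words

variable {J : Type*}

/-- The word formed by the first `n` letters of a sequence, in their order. -/
def word : ℕ → (ℕ → J) → List J
  | 0, _ => []
  | n + 1, ω => ω 0 :: word n (oneSidedShift ω)

lemma length_word (n : ℕ) (ω : ℕ → J) : (word n ω).length = n := by
  induction n generalizing ω with
  | zero => rfl
  | succ n ih => simp [word, ih]

lemma word_eq_word_iff (n : ℕ) (ω v : ℕ → J) : word n ω = word n v ↔ ∀ i < n, ω i = v i := by
  induction n generalizing ω v with
  | zero => simp [word]
  | succ n ih =>
    simp only [word, List.cons.injEq, ih, oneSidedShift]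
    constructor
    · rintro ⟨h₀, h⟩ (_ | i) hi
      · exact h₀
      · exact h i (by omega)
    · exact fun h => ⟨h 0 (by omega), fun i hi => h (i + 1) (by omega)⟩

/-- The sequence `v` preceded by the letter `j`. -/
def consSeq (j : J) (v : ℕ → J) : ℕ → J
  | 0 => j
  | i + 1 => v i

lemma word_consSeq (j : J) (v : ℕ → J) (n : ℕ) : word (n + 1) (consSeq j v) = j :: word n v := rfl

lemma exists_word_eq (j : J) (l : List J) : ∃ v, word l.length v = l := by
  induction l with
  | nil => exact ⟨fun _ => j, rfl⟩
  | cons i l ih =>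
    obtain ⟨v, hv⟩ := ih
    exact ⟨consSeq i v, by rw [List.length_cons, word_consSeq, hv]⟩

/-- The letters of a two-sided sequence read backwards from time `-1`. -/
def backward (n : ℕ) (ω : ℤ → J) : J := ω (-(n + 1 : ℤ))

lemma symm_twoSidedShift_iterate (n : ℕ) (ω : ℤ → J) (i : ℤ) :
    (twoSidedShift.symm^[n] ω) i = ω (i - n) := by
  induction n generalizing ω with
  | zero => simp
  | succ n ih =>
    rw [Function.iterate_succ_apply, ih]
    change ω (i - n - 1) = _
    congr 1
    push_cast
    ring

lemma twoSidedShift_iterate (n : ℕ) (ω : ℤ → J) (i : ℤ) :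
    (twoSidedShift^[n] ω) i = ω (i + n) := by
  induction n generalizing ω with
  | zero => simp
  | succ n ih =>
    rw [Function.iterate_succ_apply, ih]
    change ω (i + n + 1) = _
    congr 1
    push_cast
    ring

lemma oneSidedShift_restrictPlus_symm (n : ℕ) (ω : ℤ → J) :
    oneSidedShift (restrictPlus (twoSidedShift.symm^[n + 1] ω)) =
      restrictPlus (twoSidedShift.symm^[n] ω) := by
  funext i
  simp only [oneSidedShift, restrictPlus, symm_twoSidedShift_iterate]
  congr 1
  push_cast
  ring

/-- Both sides are the word ω_{-n}, …, ω_{-1}: the latest letter read backwards is the earliest in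
time. -/
lemma past_backward (n : ℕ) (ω : ℤ → J) :
    past backward n ω = word n (restrictPlus (twoSidedShift.symm^[n] ω)) := by
  induction n with
  | zero => rfl
  | succ n ih =>
    rw [past, word, oneSidedShift_restrictPlus_symm, ih]
    congr 1
    simp only [backward, restrictPlus, symm_twoSidedShift_iterate]
    refine congrArg ω ?_
    push_cast
    ring

end Words

/-! ### Time reversal of the Markov chain -/

section MarkovShift

variable {k : ℕ} {P : Measure (ℕ → Fin k)}

/-- The stationary probability of a letter. -/
def letterProb (P : Measure (ℕ → Fin k)) (j : Fin k) : ℝ := P.real {ω | ω 0 = j}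

/-- The stationary probability of a pair of consecutive letters. -/
def pairProb (P : Measure (ℕ → Fin k)) (j i : Fin k) : ℝ := P.real {ω | ω 0 = j ∧ ω 1 = i}

/-- The transition weights of the time-reversed Markov chain. -/
def reversed (P : Measure (ℕ → Fin k)) : Option (Fin k) → Fin k → ℝ
  | none, j => letterProb P j
  | some i, j => pairProb P j i / letterProb P i

/-- The probability of an initial cylinder. -/
def cylProb (P : Measure (ℕ → Fin k)) (n : ℕ) (v : ℕ → Fin k) : ℝ :=
  P.real {ω | ∀ i ≤ n, ω i = v i}

lemma measurableSet_coord (n : ℕ) (j : Fin k) : MeasurableSet {ω : ℕ → Fin k | ω n = j} :=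
  (measurable_pi_apply n : Measurable fun ω : ℕ → Fin k => ω n) (measurableSet_singleton j)

lemma measurableSet_cyl (n : ℕ) (v : ℕ → Fin k) :
    MeasurableSet {ω : ℕ → Fin k | ∀ i ≤ n, ω i = v i} := by
  simp only [Set.ofPred_forall]
  exact MeasurableSet.iInter fun i => MeasurableSet.iInter fun _ => measurableSet_coord i _

lemma letterProb_pos (hP : IsMarkovianFullShift P) (j : Fin k) : 0 < letterProb P j := by
  have := hP.prob
  have h := hP.full {0} fun _ => j
  simp only [Finset.mem_singleton, forall_eq] at h
  exact ENNReal.toReal_pos h.ne' (measure_ne_top _ _)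

lemma pairProb_pos (hP : IsMarkovianFullShift P) (j i : Fin k) : 0 < pairProb P j i := by
  have := hP.prob
  have h := hP.full {0, 1} fun n => if n = 0 then j else i
  simp only [Finset.mem_insert, Finset.mem_singleton, forall_eq_or_imp, forall_eq, if_true,
    one_ne_zero, if_false] at h
  exact ENNReal.toReal_pos h.ne' (measure_ne_top _ _)

lemma oneSidedShift_iterate (n i : ℕ) (ω : ℕ → Fin k) : (oneSidedShift^[n] ω) i = ω (i + n) := by
  induction n generalizing ω with
  | zero => rfl
  | succ n ih =>
    rw [Function.iterate_succ_apply, ih]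
    exact congrArg ω (by omega)

lemma measureReal_coord (hP : IsMarkovianFullShift P) (n : ℕ) (j : Fin k) :
    P.real {ω | ω n = j} = letterProb P j := by
  rw [letterProb, Measure.real, Measure.real,
    ← (hP.invariant.iterate n).measure_preimage (measurableSet_coord 0 j).nullMeasurableSet]
  congr 2
  ext ω
  simp [oneSidedShift_iterate]

lemma measureReal_coord_pair (hP : IsMarkovianFullShift P) (n : ℕ) (j i : Fin k) :
    P.real {ω | ω n = j ∧ ω (n + 1) = i} = pairProb P j i := by
  have h : MeasurableSet {ω : ℕ → Fin k | ω 0 = j ∧ ω 1 = i} :=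
    (measurableSet_coord 0 j).inter (measurableSet_coord 1 i)
  rw [pairProb, Measure.real, Measure.real,
    ← (hP.invariant.iterate n).measure_preimage h.nullMeasurableSet]
  congr 2
  ext ω
  simp [oneSidedShift_iterate, add_comm]

lemma reversed_pos (hP : IsMarkovianFullShift P) (o : Option (Fin k)) (j : Fin k) :
    0 < reversed P o j := by
  cases o with
  | none => exact letterProb_pos hP j
  | some i => exact div_pos (pairProb_pos hP j i) (letterProb_pos hP i)

lemma sum_reversed (hP : IsMarkovianFullShift P) (o : Option (Fin k)) :
    ∑ j, reversed P o j = 1 := by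
  have := hP.prob
  have key : ∀ s : Set (ℕ → Fin k), MeasurableSet s →
      ∑ j, P.real ({ω | ω 0 = j} ∩ s) = P.real s := by
    intro s hs
    rw [← measureReal_iUnion_fintype]
    · congr 1
      ext ω
      simp
    · intro j j' hjj'
      refine Set.disjoint_left.2 fun ω h h' => hjj' ?_
      exact h.1.symm.trans h'.1
    · exact fun j => (measurableSet_coord 0 j).inter hs
  cases o with
  | none => simpa [reversed, letterProb] using key Set.univ MeasurableSet.univ
  | some i =>
    simp only [reversed]
    rw [← Finset.sum_div, div_eq_one_iff_eq (letterProb_pos hP i).ne', ← measureReal_coord hP 1 i]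
    exact key _ (measurableSet_coord 1 i)

/-- The Markov property with denominators cleared; stationarity moves the one-letter and two-letter
events to time 0. -/
lemma cylProb_succ_mul (hP : IsMarkovianFullShift P) (n : ℕ) (v : ℕ → Fin k) :
    cylProb P (n + 1) v * letterProb P (v n) = cylProb P n v * pairProb P (v n) (v (n + 1)) := by
  have := hP.prob
  have hpos : P {ω | ∀ i ≤ n, ω i = v i} ≠ 0 := by
    have := hP.full (Finset.range (n + 1)) v
    simp only [Finset.mem_range, Nat.lt_succ_iff] at this
    exact this.ne'
  have hpos' : 0 < cylProb P n v := ENNReal.toReal_pos hpos (measure_ne_top _ _)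
  have h := congrArg ENNReal.toReal (hP.markovian n v (v (n + 1)) hpos)
  rw [ProbabilityTheory.cond_apply (measurableSet_cyl n v),
    ProbabilityTheory.cond_apply (measurableSet_coord n (v n)), ENNReal.toReal_mul,
    ENNReal.toReal_mul, ENNReal.toReal_inv, ENNReal.toReal_inv] at h
  have h₁ : {ω : ℕ → Fin k | ∀ i ≤ n, ω i = v i} ∩ {ω | ω (n + 1) = v (n + 1)} =
      {ω | ∀ i ≤ n + 1, ω i = v i} := by
    ext ω
    constructor
    · rintro ⟨h₂, h₃⟩ i hi
      rcases Nat.le_succ_iff.1 hi with hi | rfl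
      · exact h₂ i hi
      · exact h₃
    · exact fun h₂ => ⟨fun i hi => h₂ i (by omega), h₂ _ le_rfl⟩
  rw [h₁] at h
  change (cylProb P n v)⁻¹ * cylProb P (n + 1) v = (P.real {ω | ω n = v n})⁻¹ *
    P.real {ω | ω n = v n ∧ ω (n + 1) = v (n + 1)} at h
  rw [measureReal_coord hP, measureReal_coord_pair hP] at h
  have := letterProb_pos hP (v n)
  field_simp at h
  linarith

lemma cylProb_zero (v : ℕ → Fin k) : cylProb P 0 v = letterProb P (v 0) := by
  simp [cylProb, letterProb]

/-- The Markov property in reversed time: the letter before a word interacts only with its first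
letter. The proof adds letters at the far end. -/
lemma cylProb_consSeq (hP : IsMarkovianFullShift P) (j : Fin k) (v : ℕ → Fin k) (n : ℕ) :
    cylProb P (n + 1) (consSeq j v) * letterProb P (v 0) = pairProb P j (v 0) * cylProb P n v := by
  induction n with
  | zero =>
    have h : cylProb P 1 (consSeq j v) = pairProb P j (v 0) := by
      rw [cylProb, pairProb]
      congr 1
      ext ω
      simp [Nat.le_one_iff_eq_zero_or_eq_one, consSeq]
    rw [zero_add, h, cylProb_zero]
  | succ n ih =>
    have h₁ := cylProb_succ_mul hP (n + 1) (consSeq j v)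
    have h₂ := cylProb_succ_mul hP n v
    have h₃ := letterProb_pos hP (v n)
    simp only [consSeq] at h₁
    refine mul_right_cancel₀ h₃.ne' ?_
    linear_combination letterProb P (v 0) * h₁ + pairProb P (v n) (v (n + 1)) * ih -
      pairProb P j (v 0) * h₂

lemma measureReal_word_eq (n : ℕ) (v : ℕ → Fin k) :
    P.real {ω | word (n + 1) ω = word (n + 1) v} = cylProb P n v := by
  simp only [word_eq_word_iff, cylProb, Nat.lt_succ_iff]

lemma measureReal_word_cons (hP : IsMarkovianFullShift P) (n : ℕ) (l : List (Fin k)) (j : Fin k) :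
    P.real {ω | word (n + 1) ω = j :: l} = reversed P l.head? j * P.real {ω | word n ω = l} := by
  have := hP.prob
  by_cases hl : l.length = n
  · obtain ⟨v, hv⟩ := exists_word_eq j l
    rw [hl] at hv
    subst hv
    rw [← word_consSeq, measureReal_word_eq]
    cases n with
    | zero => simp [word, reversed, cylProb_zero, consSeq]
    | succ n =>
      rw [measureReal_word_eq]
      simp only [word, List.head?_cons, reversed]
      have := letterProb_pos hP (v 0)
      field_simp
      exact cylProb_consSeq hP j v n
  · have h₁ : {ω : ℕ → Fin k | word n ω = l} = ∅ :=
      Set.eq_empty_of_forall_notMem fun ω hω => hl (hω ▸ length_word n ω)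
    have h₂ : {ω : ℕ → Fin k | word (n + 1) ω = j :: l} = ∅ :=
      Set.eq_empty_of_forall_notMem fun ω hω => hl (by
        have h : word (n + 1) ω = j :: l := hω
        simpa [h] using length_word (n + 1) ω)
    simp [h₁, h₂]

variable {P₂ : Measure (ℤ → Fin k)}

lemma measurable_restrictPlus : Measurable (restrictPlus : (ℤ → Fin k) → ℕ → Fin k) :=
  measurable_pi_lambda _ fun i => measurable_pi_apply (i : ℤ)

lemma measurable_backward (n : ℕ) : Measurable (backward n : (ℤ → Fin k) → Fin k) :=
  measurable_pi_apply _

lemma IsTwoSidedExtension.isProbabilityMeasure (hP : IsMarkovianFullShift P)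
    (hP₂ : IsTwoSidedExtension P P₂) : IsProbabilityMeasure P₂ := by
  have := hP.prob
  refine ⟨?_⟩
  have h : P Set.univ = 1 := measure_univ
  rwa [← hP₂.map_restrict, Measure.map_apply measurable_restrictPlus MeasurableSet.univ,
    Set.preimage_univ] at h

lemma measurableSet_word (n : ℕ) (l : List (Fin k)) :
    MeasurableSet {ω : ℕ → Fin k | word n ω = l} := by
  induction n generalizing l with
  | zero => exact MeasurableSet.const ([] = l)
  | succ n ih =>
    cases l with
    | nil => simp [word]
    | cons j l =>
      have : {ω : ℕ → Fin k | word (n + 1) ω = j :: l} =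
          {ω | ω 0 = j} ∩ oneSidedShift ⁻¹' {ω | word n ω = l} := by
        ext ω; simp [word]
      rw [this]
      have hm : Measurable (oneSidedShift : (ℕ → Fin k) → ℕ → Fin k) :=
        measurable_pi_lambda _ fun i => measurable_pi_apply (i + 1)
      exact (measurableSet_coord 0 j).inter (hm (ih l))

/-- Shift invariance carries the coordinates -n, …, -1 to 0, …, n-1, where the measure is `P`. -/
lemma measureReal_past (hP₂ : IsTwoSidedExtension P P₂) (n : ℕ) (l : List (Fin k)) :
    P₂.real {ω | past backward n ω = l} = P.real {ω | word n ω = l} := by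
  have h₁ : MeasurableSet {ω : ℤ → Fin k | past backward n ω = l} :=
    measurableSet_past_preimage measurable_backward n {l}
  rw [Measure.real, Measure.real,
    ← (hP₂.invariant.iterate n).measure_preimage h₁.nullMeasurableSet, ← hP₂.map_restrict,
    Measure.map_apply measurable_restrictPlus (measurableSet_word n l)]
  congr 2
  ext ω
  have h₂ : restrictPlus (twoSidedShift.symm^[n] (twoSidedShift^[n] ω)) = restrictPlus ω := by
    funext i
    simp [restrictPlus, symm_twoSidedShift_iterate, twoSidedShift_iterate]
  simp [past_backward, h₂]

lemma hasTransitions (hP : IsMarkovianFullShift P) (hP₂ : IsTwoSidedExtension P P₂) :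
    HasTransitions P₂ backward (reversed P) := fun n l j => by
  rw [measureReal_past hP₂, measureReal_past hP₂, measureReal_word_cons hP]

end MarkovShift

/-! ### From the random dynamical system to words -/

section System

variable {k d : ℕ} {Φ : LRDS k d}

/-- The generator of the system attached to a letter. -/
def generator (Φ : LRDS k d) (j : Fin k) : Eucl d →L[ℝ] Eucl d := Φ.φ 1 fun _ => j

lemma φ_eq_wordProd (hfirst : Φ.DependsOnFirst) (n : ℕ) (ω : ℕ → Fin k) :
    Φ.φ n ω = wordProd (generator Φ) (word n ω) := by
  induction n generalizing ω with
  | zero => exact Φ.zero ω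
  | succ n ih =>
    rw [add_comm, Φ.cocycle, add_comm, word, wordProd, ← ih, generator,
      hfirst ω (fun _ => ω 0) rfl]
    rfl

lemma pullback_eq_wordProd (hfirst : Φ.DependsOnFirst) (n : ℕ) (ω : ℤ → Fin k) :
    Φ.pullback n ω = wordProd (generator Φ) (past backward n ω) := by
  rw [LRDS.pullback, φ_eq_wordProd hfirst, past_backward]

lemma mem_semigroup_iff (hfirst : Φ.DependsOnFirst) (j : Fin k) (B : Eucl d →L[ℝ] Eucl d) :
    B ∈ Φ.semigroup ↔ ∃ l, B = wordProd (generator Φ) l := by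
  constructor
  · rintro ⟨n, ω, rfl⟩
    exact ⟨_, φ_eq_wordProd hfirst n ω⟩
  · rintro ⟨l, rfl⟩
    obtain ⟨v, hv⟩ := exists_word_eq j l
    exact ⟨l.length, v, by rw [φ_eq_wordProd hfirst, hv]⟩

/-- A finite family permuted by the generators has a union mapped onto itself by each of them, hence
by all their products. -/
lemma noFiniteInvariantFamily (hfirst : Φ.DependsOnFirst) (j : Fin k)
    (hirr : Φ.StronglyIrreducible) : NoFiniteInvariantFamily (generator Φ) := by
  rintro ⟨F, hF, hne, hprop, hinv⟩
  obtain ⟨m, W, -, rfl⟩ := hF.fin_param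
  refine hirr ⟨m, W, ?_, fun i => hprop _ ⟨i, rfl⟩, ?_⟩
  · obtain ⟨_, i, rfl⟩ := hne
    exact i.pos
  have key : ∀ i, generator Φ i '' (⋃ a, (W a : Set (Eucl d))) = ⋃ a, (W a : Set (Eucl d)) := by
    intro i
    have h := congrArg (fun F : Set (Submodule ℝ (Eucl d)) => ⋃ V ∈ F, (V : Set (Eucl d)))
      (hinv i)
    simpa [Set.image_iUnion] using h
  intro B hB
  obtain ⟨l, rfl⟩ := (mem_semigroup_iff hfirst j B).1 hB
  induction l with
  | nil => simp [wordProd]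
  | cons i l ih =>
    have : ⇑(wordProd (generator Φ) (i :: l)) = wordProd (generator Φ) l ∘ generator Φ i := rfl
    rw [this, Set.image_comp, key, ih ((mem_semigroup_iff hfirst j _).2 ⟨l, rfl⟩)]

end System

end RandomProduct

end

/-! ### Conclusion -/

open RandomProduct in
theorem mainTheorem6 {k d r : ℕ} (P : Measure (ℕ → Fin k)) (hP : IsMarkovianFullShift P)
    (P₂ : Measure (ℤ → Fin k)) (hP₂ : IsTwoSidedExtension P P₂)
    (Φ : LRDS k d) (hinv : Φ.SpatiallyInvertible) (hfirst : Φ.DependsOnFirst)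
    (hirr : Φ.StronglyIrreducible) (hr : Φ.HasIndex r) :
    ∃ V : (ℤ → Fin k) → Submodule ℝ (Eucl d),
      (∀ᵐ ω ∂P₂, Module.finrank ℝ (V ω) = r ∧
        ∀ R : Eucl d →L[ℝ] Eucl d,
          MapClusterPt R atTop (fun n : ℕ => ‖Φ.pullback n ω‖⁻¹ • Φ.pullback n ω) →
            LinearMap.range (R : Eucl d →ₗ[ℝ] Eucl d) = V ω) ∧
      ∀ x : Eucl d, x ≠ 0 → P₂ {ω | x ∈ (V ω)ᗮ} = 0 := by
  obtain ⟨⟨M, L, hM, hL, hLr⟩, hmin⟩ := hr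
  -- In dimension 0 there are no unit vectors to carry a measure, but there `r = 0` and nothing is
  -- left to prove.
  rcases subsingleton_or_nontrivial (Eucl d) with hd | hd
  · refine ⟨fun _ => ⊥, ae_of_all _ fun ω => ⟨?_, fun R _ => Subsingleton.elim _ _⟩,
      fun x hx => absurd (Subsingleton.elim x 0) hx⟩
    rw [← hLr, Module.finrank_zero_of_subsingleton, Module.finrank_zero_of_subsingleton]
  have := hP₂.isProbabilityMeasure hP
  have hPprob := hP.prob
  -- This supplies a letter, needed to continue finite words to infinite sequences.
  obtain ⟨ω₀⟩ : Nonempty (ℕ → Fin k) := P.nonempty_of_neZero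
  have hmem := mem_semigroup_iff hfirst (ω₀ 0)
  simp only [pullback_eq_wordProd hfirst]
  refine exists_limit_range (A := generator Φ) (fun j => hinv _)
    (noFiniteInvariantFamily hfirst (ω₀ 0) hirr)
    (reversed_pos hP) (sum_reversed hP) measurable_backward (hasTransitions hP hP₂) ?_ ?_
  · choose w hw using fun i => (hmem (M i)).1 (hM i)
    exact ⟨w, L, by simpa only [hw] using hL, hLr⟩
  · exact fun w L' hL' => hmin ⟨_, L', fun i => (hmem _).2 ⟨w i, rfl⟩, hL', rfl⟩
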